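/- **Definitions.** The squared singular values of a complex matrix $A$ with $n$ columns are the $n$ eigenvalues of $A^*A$, counted with multiplicity. Real-valued functions $f_1,\dots,f_n$ on $(0,\infty)$ define a *polynomial ensemble* if $\int_0^\infty x^{j-1}f_k(x)\,dx$ converges absolutely for $1\le j,k\le n$ and if, for some constant $Z\neq 0$, $$\mathcal P(x_1,\dots,x_n)=\frac1Z\,\Delta_n(x)\,\det\bigl[f_k(x_j)\bigr]_{j,k=1}^n,\qquad \text{all } x_j>0,\qquad \Delta_n(x)=\prod_{j<k}(x_k-x_j),$$ extended by $0$ to $\mathbb R^n$, is non-negative everywhere and has integral $1$ (if $n=0$, the density is the constant $1$ on the one-point space). The squared singular values of a random matrix $X$ with $n$ columns *are a polynomial ensemble with functions $f_1,\dots,f_n$* if these functions define a polynomial ensemble and the unordered squared singular values (listed in a uniformly random order) have joint density $\mathcal P$ on $\mathbb R^n$. **Corollary.** Let $n\ge 1$ and $\nu\ge 0$ be integers. Let $X$ be a random complex $(n+\nu)\times n$ matrix whose squared singular values are a polynomial ensemble with functions $f_1,\dots,f_n$. Let $U$ be a Haar distributed random $n\times n$ unitary matrix, independent of $X$, and let $Y$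 be the $(n+\nu)\times(n-1)$ matrix obtained from $XU$ by removing one (fixed) column. Then the real vector space $$V=\Bigl\{f=\sum_{j=1}^n c_jf_j \;\Big|\; c_1,\dots,c_n\in\mathbb R,\ \int_0^\infty f(x)\,dx=0\Bigr\}$$ has dimension $n-1$, and for every basis $\tilde f_1,\dots,\tilde f_{n-1}$ of $V$ the squared singular values $y_1,\dots,y_{n-1}$ of $Y$ are a polynomial ensemble with functions $$g_k(y)=\int_0^y\tilde f_k(x)\,dx,\qquad k=1,\dots,n-1;$$ that is, they have joint density $\frac1{\tilde Z_{n-1}}\,\Delta_{n-1}(y)\,\det\bigl[g_k(y_j)\bigr]_{j,k=1}^{n-1}$, all $y_j>0$, for some constant $\tilde Z_{n-1}\ne0$. -/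

import Mathlib

open MeasureTheory ProbabilityTheory
open scoped ENNReal Matrix Nat

noncomputable section

/-- The entrywise (product) sigma-algebra on complex matrices, which is the Borel one. The unitary
group carries the induced sigma-algebra. -/
instance complexMatrixMeasurableSpace {m n : ℕ} :
    MeasurableSpace (Matrix (Fin m) (Fin n) ℂ) :=
  inferInstanceAs (MeasurableSpace (Fin m → Fin n → ℂ))

/-- The squared singular values of a rectangular complex matrix `A` with `n` columns, i.e. the
`n` eigenvalues (with multiplicity) of `Aᴴ * A`, listed in the order of Mathlib. -/
def squaredSingularValues {m n : ℕ} (A : Matrix (Fin m) (Fin n) ℂ) : Fin n → ℝ :=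
  (Matrix.isHermitian_conjTranspose_mul_self A).eigenvalues

/-- The joint law on `ℝⁿ` of the *unordered* squared singular values of a random matrix `X`: the
average, over all `n!` ways of listing them, of the laws of the listed values. -/
def squaredSingularValuesLaw {Ω : Type*} [MeasurableSpace Ω] (μ : Measure Ω) {m n : ℕ}
    (X : Ω → Matrix (Fin m) (Fin n) ℂ) : Measure (Fin n → ℝ) :=
  ((n ! : ℕ) : ℝ≥0∞)⁻¹ •
    ∑ σ : Equiv.Perm (Fin n), μ.map (fun ω i => squaredSingularValues (X ω) (σ i))

open Classical in
/-- The function `Z⁻¹ Δ_n(x) det [f_k(x_j)]` on `(0, ∞)ⁿ`, extended by zero to `ℝⁿ`. Here `Δ_n` is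
the Vandermonde determinant. Only the values of the `f_k` on the positive half line matter. -/
def polynomialEnsembleDensity {n : ℕ} (f : Fin n → ℝ → ℝ) (Z : ℝ) (x : Fin n → ℝ) : ℝ :=
  if ∀ j, 0 < x j then
    Z⁻¹ * (Matrix.vandermonde x).det * (Matrix.of fun j k => f k (x j)).det
  else 0

/-- `f_1, …, f_n` define a polynomial ensemble on the positive half line with normalization
constant `Z`: the moments of orders `0, …, n - 1` converge, and `Z⁻¹ Δ_n(x) det [f_k(x_j)]` is a
probability density. (Linear independence of the `f_k` on the half line follows from `mass`.) -/
structure IsPolynomialEnsemble {n : ℕ} (f : Fin n → ℝ → ℝ) (Z : ℝ) : Prop where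
  normalization_ne_zero : Z ≠ 0
  moments : ∀ j k : Fin n, IntegrableOn (fun x : ℝ => x ^ (j : ℕ) * f k x) (Set.Ioi 0)
  nonneg : ∀ x, 0 ≤ polynomialEnsembleDensity f Z x
  mass : ∫⁻ x, ENNReal.ofReal (polynomialEnsembleDensity f Z x) = 1

/-- The squared singular values of the random matrix `X` are a polynomial ensemble with functions
`f_1, …, f_n`: their joint law has a density of the form `Z⁻¹ Δ_n(x) det [f_k(x_j)]`, all
`x_j > 0`. The constant `Z` is determined by the `f_k`. -/
def SquaredSingularValuesArePolynomialEnsemble {Ω : Type*} [MeasurableSpace Ω] (μ : Measure Ω)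
    {m n : ℕ} (X : Ω → Matrix (Fin m) (Fin n) ℂ) (f : Fin n → ℝ → ℝ) : Prop :=
  ∃ Z : ℝ, IsPolynomialEnsemble f Z ∧
    squaredSingularValuesLaw μ X =
      volume.withDensity fun x => ENNReal.ofReal (polynomialEnsembleDensity f Z x)

/-- The vector space of all real linear combinations `f = ∑ c_j f_j` with `∫_0^∞ f(x) dx = 0`
(the integral being required to converge). -/
def zeroIntegralCombinations {n : ℕ} (f : Fin n → ℝ → ℝ) : Submodule ℝ (ℝ → ℝ) where
  carrier := {g | (∃ c : Fin n → ℝ, g = ∑ j, c j • f j) ∧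
    IntegrableOn g (Set.Ioi 0) ∧ ∫ x in Set.Ioi (0 : ℝ), g x = 0}
  zero_mem' := ⟨⟨0, by simp⟩, integrableOn_zero, by simp⟩
  add_mem' := by
    rintro a b ⟨⟨c, hc⟩, ha, ha0⟩ ⟨⟨d, hd⟩, hb, hb0⟩
    refine ⟨⟨c + d, ?_⟩, ha.add hb, ?_⟩
    · simp [hc, hd, add_smul, Finset.sum_add_distrib]
    · simp only [Pi.add_apply]
      rw [integral_add ha hb, ha0, hb0, add_zero]
  smul_mem' := by
    rintro r a ⟨⟨c, hc⟩, ha, ha0⟩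
    refine ⟨⟨r • c, ?_⟩, ha.smul r, ?_⟩
    · simp [hc, mul_smul, Finset.smul_sum]
    · simp only [Pi.smul_apply]
      rw [integral_smul, ha0, smul_zero]

end

/-! Let `x` be the squared singular values of `X`, let `V` diagonalize `Xᴴ X`, and let `y` be the
squared singular values after the column is removed. The characteristic polynomial of `y` is `∑ i, w
i ∏ k ≠ i, (z - x k)`, where the `w i` are the squared moduli of the `p`-th column of `V⋆ U`
(`charValues_corner`). By Haar invariance this column is uniform on the unit sphere. Up to a scalar,
the polynomial depends only on the ratios of the weights, so the sphere may be replaced by the ball,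
which makes `w` uniform on `{w i > 0, ∑ w i ≤ 1}` (`lintegral_haar_corner`).

A polynomial with positive weights has exactly one root in each gap of `x`, and (leading coefficient
`s`, roots `y`) are coordinates on the orthant of weights with Jacobian `s ^ n Δ(y) / Δ(x)`. Hence,
given `x`, the density of `y` is proportional to `Δ(y) / Δ(x)` on the interlacing set
(`simplexAverage_eq`). Multiplying by the density of `x` cancels `Δ(x)`. For fixed `y` the
interlacing `x` fill a box, so integrating out `x` leaves `Δ(y)` times a determinant of integrals of
the `f k`, which row operations bring to the intervals `(0, y 1), …, (0, y n), (0, ∞)`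
(`lintegral_density_mul_simplexAverage`).

In a basis consisting of zero-integral functions and one function of integral one, the row of `(0,
∞)` is `(0, …, 0, 1)`, and the determinant of the primitives remains, up to a nonzero constant
(`exists_det_initialIntegrals_eq`). The determinant of integrals is not identically zero because the
total mass is one; this also yields the dimension of the space.

Unordered vectors are encoded by the values of their characteristic polynomial at the natural
numbers. Laws are compared by testing functions of this code, up to constants that the total mass
fixes at the end (`squaredSingularValuesArePolynomialEnsemble_of_lintegral`). -/

/-! ### Encoding unordered vectors by their characteristic polynomials -/

/-- The values at the natural numbers of the monic polynomial with roots `y`. -/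
def charValues {n : ℕ} (y : Fin n → ℝ) : ℕ → ℝ := fun t => ∏ j, ((t : ℝ) - y j)

lemma charValues_comp_perm {n : ℕ} (y : Fin n → ℝ) (σ : Equiv.Perm (Fin n)) :
    charValues (y ∘ σ) = charValues y := by
  funext t
  exact Equiv.prod_comp σ (fun j => (t : ℝ) - y j)

lemma continuous_charValues {n : ℕ} : Continuous (charValues (n := n)) := by
  unfold charValues
  fun_prop

lemma polynomial_eq_of_forall_nat_eval {p q : Polynomial ℝ}
    (h : ∀ t : ℕ, p.eval (t : ℝ) = q.eval (t : ℝ)) : p = q := by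
  apply Polynomial.eq_of_infinite_eval_eq
  refine Set.Infinite.mono ?_ (Set.infinite_range_of_injective (Nat.cast_injective (R := ℝ)))
  rintro _ ⟨t, rfl⟩
  exact h t

lemma map_univ_eq_of_charValues_eq {n : ℕ} {y z : Fin n → ℝ} (h : charValues y = charValues z) :
    Multiset.map y Finset.univ.val = Multiset.map z Finset.univ.val := by
  have key : (∏ j, (Polynomial.X - Polynomial.C (y j))) =
      ∏ j, (Polynomial.X - Polynomial.C (z j)) := by
    apply polynomial_eq_of_forall_nat_eval
    intro t
    simpa [Polynomial.eval_prod, charValues] using congrFun h t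
  have := congrArg Polynomial.roots key
  have e : ∀ w : Fin n → ℝ, (∏ j, (Polynomial.X - Polynomial.C (w j))) =
      ((Multiset.map w Finset.univ.val).map (fun a => Polynomial.X - Polynomial.C a)).prod := by
    intro w
    rw [Multiset.map_map]
    rfl
  rwa [e, e, Polynomial.roots_multiset_prod_X_sub_C, Polynomial.roots_multiset_prod_X_sub_C]
    at this

lemma eq_of_charValues_eq_of_monotone {n : ℕ} {y z : Fin n → ℝ} (hy : Monotone y)
    (hz : Monotone z) (h : charValues y = charValues z) : y = z := by
  have h1 := map_univ_eq_of_charValues_eq h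
  rw [Fin.univ_val_map, Fin.univ_val_map, Multiset.coe_eq_coe] at h1
  exact List.ofFn_injective (h1.eq_of_sortedLE hy.sortedLE_ofFn hz.sortedLE_ofFn)

lemma isClosed_setOf_monotone {n : ℕ} : IsClosed {y : Fin n → ℝ | Monotone y} := by
  have : {y : Fin n → ℝ | Monotone y} = ⋂ i, ⋂ j, ⋂ (_ : i ≤ j), {y | y i ≤ y j} := by
    ext y; simp [Monotone]
  rw [this]
  refine isClosed_iInter fun i => isClosed_iInter fun j => isClosed_iInter fun _ => ?_
  exact isClosed_le (continuous_apply i) (continuous_apply j)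

/-- Sorted vectors form a closed, hence Polish, space, and a continuous injection of a Polish space
is a measurable embedding (Lusin–Souslin). This replaces any argument about the continuity of roots.
-/
lemma measurableEmbedding_charValues {n : ℕ} :
    MeasurableEmbedding (fun y : {y : Fin n → ℝ | Monotone y} => charValues (y : Fin n → ℝ)) := by
  have : PolishSpace {y : Fin n → ℝ | Monotone y} := isClosed_setOf_monotone.polishSpace
  refine (continuous_charValues.comp continuous_subtype_val).measurableEmbedding ?_
  intro y z h
  exact Subtype.ext (eq_of_charValues_eq_of_monotone y.2 z.2 h)

/-- A vector-valued function, each value of which is sorted by one fixed permutation, is measurable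
as soon as the polynomials with these roots depend measurably on the argument. -/
lemma measurable_of_charValues {α : Type*} [MeasurableSpace α] {n : ℕ} {g : α → Fin n → ℝ}
    (τ : Equiv.Perm (Fin n)) (hτ : ∀ a, Monotone (g a ∘ τ))
    (h : Measurable fun a => charValues (g a)) : Measurable g := by
  have h1 : Measurable fun a => (⟨g a ∘ τ, hτ a⟩ : {y : Fin n → ℝ | Monotone y}) := by
    rw [← measurableEmbedding_charValues.measurable_comp_iff]
    have h3 : (fun a => charValues (g a)) = fun a => charValues (g a ∘ τ) := by
      funext a
      rw [charValues_comp_perm]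
    rw [h3] at h
    exact h
  have h2 : Measurable fun a => g a ∘ τ := measurable_subtype_coe.comp h1
  rw [measurable_pi_iff] at h2 ⊢
  intro i
  simpa using h2 (τ.symm i)

/-- A symmetric function is determined by its restriction to sorted vectors, which extends
measurably along the embedding. -/
lemma exists_eq_comp_charValues {n : ℕ} {h : (Fin n → ℝ) → ℝ≥0∞} (hm : Measurable h)
    (hs : ∀ y (σ : Equiv.Perm (Fin n)), h (y ∘ σ) = h y) :
    ∃ H : (ℕ → ℝ) → ℝ≥0∞, Measurable H ∧ ∀ y, h y = H (charValues y) := by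
  obtain ⟨H, hH, hHe⟩ := (measurableEmbedding_charValues (n := n)).exists_measurable_extend
    (hm.comp measurable_subtype_coe) (fun _ => ⟨0⟩)
  refine ⟨H, hH, fun y => ?_⟩
  have := congrFun hHe ⟨y ∘ Tuple.sort y, Tuple.monotone_sort y⟩
  simp only [Function.comp_apply, charValues_comp_perm] at this
  rw [this, hs]

/-! ### The Weyl chamber and permutation invariance -/

lemma measurableSet_strictMono {n : ℕ} : MeasurableSet {y : Fin n → ℝ | StrictMono y} := by
  have : {y : Fin n → ℝ | StrictMono y} = ⋂ i, ⋂ j, ⋂ (_ : i < j), {y | y i < y j} := by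
    ext y; simp [StrictMono]
  rw [this]
  refine MeasurableSet.iInter fun i => MeasurableSet.iInter fun j => MeasurableSet.iInter fun _ => ?_
  exact measurableSet_lt (measurable_pi_apply i) (measurable_pi_apply j)

lemma ae_injective {n : ℕ} : ∀ᵐ y : Fin n → ℝ, Function.Injective y := by
  have : ∀ i j : Fin n, i ≠ j → ∀ᵐ y : Fin n → ℝ, y i ≠ y j := by
    intro i j hij
    have h0 := Measure.addHaar_submodule (volume : Measure (Fin n → ℝ))
      (LinearMap.ker ((LinearMap.proj i : (Fin n → ℝ) →ₗ[ℝ] ℝ) - LinearMap.proj j)) (by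
        intro h
        rw [LinearMap.ker_eq_top] at h
        have := LinearMap.congr_fun h (Pi.single i 1)
        simp [hij] at this)
    rw [ae_iff]
    convert h0 using 2
    ext y
    simp [sub_eq_zero]
  have h2 : ∀ᵐ y : Fin n → ℝ, ∀ i j : Fin n, i ≠ j → y i ≠ y j := by
    simp only [ae_all_iff, Filter.eventually_imp_distrib_left]
    exact this
  filter_upwards [h2] with y hy i j hij
  by_contra hne
  exact hy i j hne hij

lemma comp_perm_eq_piCongrLeft {n : ℕ} (σ : Equiv.Perm (Fin n)) :
    (fun y : Fin n → ℝ => y ∘ σ) = MeasurableEquiv.piCongrLeft (fun _ : Fin n => ℝ) σ.symm := by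
  funext y i
  have := MeasurableEquiv.piCongrLeft_apply_apply (σ.symm) (β := fun _ : Fin n => ℝ) y (σ i)
  simpa using this.symm

lemma measurePreserving_comp_perm {n : ℕ} (σ : Equiv.Perm (Fin n)) :
    MeasurePreserving (fun y : Fin n → ℝ => y ∘ σ) := by
  rw [comp_perm_eq_piCongrLeft]
  exact volume_measurePreserving_piCongrLeft (fun _ : Fin n => ℝ) σ.symm

lemma measurableEmbedding_comp_perm {n : ℕ} (σ : Equiv.Perm (Fin n)) :
    MeasurableEmbedding (fun y : Fin n → ℝ => y ∘ σ) := by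
  rw [comp_perm_eq_piCongrLeft]
  exact (MeasurableEquiv.piCongrLeft (fun _ : Fin n => ℝ) σ.symm).measurableEmbedding

lemma lintegral_comp_perm {n : ℕ} (σ : Equiv.Perm (Fin n)) (F : (Fin n → ℝ) → ℝ≥0∞) :
    ∫⁻ y, F (y ∘ σ) = ∫⁻ y, F y :=
  (measurePreserving_comp_perm σ).lintegral_comp_emb (measurableEmbedding_comp_perm σ) F

/-- The integral of a symmetric function is `n!` times the integral over the Weyl chamber. -/
lemma lintegral_eq_factorial_mul_setLIntegral_strictMono {n : ℕ} {F : (Fin n → ℝ) → ℝ≥0∞}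
    (hF : ∀ y (σ : Equiv.Perm (Fin n)), F (y ∘ σ) = F y) :
    ∫⁻ y, F y = (n ! : ℕ) * ∫⁻ y in {y | StrictMono y}, F y := by
  -- The `n!` permuted chambers are disjoint and cover everything except the null set of vectors
  -- with coinciding coordinates.
  set A : Equiv.Perm (Fin n) → Set (Fin n → ℝ) := fun σ => {y | StrictMono (y ∘ σ)} with hA
  have hAm : ∀ σ, MeasurableSet (A σ) := fun σ =>
    (measurePreserving_comp_perm σ).measurable measurableSet_strictMono
  have hdisj : Pairwise (Function.onFun Disjoint A) := by
    intro σ τ hne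
    rw [Function.onFun, Set.disjoint_left]
    intro y h1 h2
    apply hne
    have h3 : y ∘ σ = y ∘ τ := Tuple.unique_monotone h1.monotone h2.monotone
    have hinj : Function.Injective y := by
      have := h1.injective
      have h4 := this.comp σ.symm.injective
      simpa [Function.comp_def] using h4
    ext1 i
    exact hinj (congrFun h3 i)
  have huniv : (⋃ σ, A σ) =ᵐ[volume] Set.univ := by
    rw [Filter.eventuallyEq_set]
    filter_upwards [ae_injective] with y hy
    simp only [Set.mem_iUnion, Set.mem_univ, iff_true]
    exact ⟨Tuple.sort y, (Tuple.monotone_sort y).strictMono_of_injective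
      (hy.comp (Tuple.sort y).injective)⟩
  rw [← setLIntegral_univ, ← setLIntegral_congr huniv, lintegral_iUnion hAm hdisj, tsum_fintype]
  have : ∀ σ, ∫⁻ y in A σ, F y = ∫⁻ y in {y | StrictMono y}, F y := by
    intro σ
    have := (measurePreserving_comp_perm σ).setLIntegral_comp_preimage_emb
      (measurableEmbedding_comp_perm σ) F {y | StrictMono y}
    rw [← this]
    simp [hF, hA]
  simp [this, Finset.card_univ, Fintype.card_perm]

/-! ### Unitarily invariant measures on complex space -/

lemma measurable_matrix_entry {m n : ℕ} (i : Fin m) (j : Fin n) :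
    Measurable fun A : Matrix (Fin m) (Fin n) ℂ => A i j :=
  (measurable_pi_apply j).comp (measurable_pi_apply i)

lemma measurable_matrix_iff {α : Type*} [MeasurableSpace α] {m n : ℕ}
    {A : α → Matrix (Fin m) (Fin n) ℂ} :
    Measurable A ↔ ∀ i j, Measurable fun a => A a i j := by
  constructor
  · intro h i j
    exact (measurable_matrix_entry i j).comp h
  · intro h
    exact measurable_pi_lambda _ fun i => measurable_pi_lambda _ fun j => h i j

lemma measurable_unitary_entry {m : ℕ} (i j : Fin m) :
    Measurable fun U : Matrix.unitaryGroup (Fin m) ℂ => (U : Matrix (Fin m) (Fin m) ℂ) i j :=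
  (measurable_matrix_entry i j).comp measurable_subtype_coe

lemma measurable_unitary_mul_left {m : ℕ} (W : Matrix.unitaryGroup (Fin m) ℂ) :
    Measurable fun U : Matrix.unitaryGroup (Fin m) ℂ => W * U := by
  apply Measurable.subtype_mk
  rw [measurable_matrix_iff]
  intro i j
  simp only [Matrix.mul_apply]
  exact Finset.measurable_sum _ fun k _ => (measurable_unitary_entry k j).const_mul _

/-- The normalized vector extends to an orthonormal basis, whose matrix is `W`. The scalar is
harmless for functions homogeneous of degree zero. -/
lemma exists_unitary_mulVec_single {m : ℕ} {g : Fin m → ℂ} (hg : g ≠ 0) (p : Fin m) :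
    ∃ W : Matrix.unitaryGroup (Fin m) ℂ, ∃ c : ℂ, c ≠ 0 ∧
      (W : Matrix (Fin m) (Fin m) ℂ) *ᵥ Pi.single p 1 = c • g := by
  have hg' : WithLp.toLp 2 g ≠ 0 := by simpa using hg
  set v : EuclideanSpace ℂ (Fin m) := ((‖WithLp.toLp 2 g‖ : ℂ)⁻¹) • WithLp.toLp 2 g with hv
  have hvn : ‖v‖ = 1 := by
    rw [hv, norm_smul, norm_inv, Complex.norm_real, norm_norm]
    exact inv_mul_cancel₀ (norm_ne_zero_iff.mpr hg')
  have ho : Orthonormal ℂ (({p} : Set (Fin m)).domRestrict fun _ => v) := by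
    rw [orthonormal_iff_ite]
    rintro ⟨i, rfl⟩ ⟨j, rfl⟩
    simp [Set.domRestrict, inner_self_eq_norm_sq_to_K, hvn]
  obtain ⟨b, hb⟩ := ho.exists_orthonormalBasis_extension_of_card_eq (by simp)
  refine ⟨⟨(EuclideanSpace.basisFun (Fin m) ℂ).toBasis.toMatrix b,
    (EuclideanSpace.basisFun (Fin m) ℂ).toMatrix_orthonormalBasis_mem_unitary b⟩,
    (‖WithLp.toLp 2 g‖ : ℂ)⁻¹, by simpa using hg, ?_⟩
  ext i
  have := hb p rfl
  simp [Module.Basis.toMatrix_apply, this, hv]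

lemma measurable_star_mulVec {m : ℕ} :
    Measurable fun q : Matrix.unitaryGroup (Fin m) ℂ × (Fin m → ℂ) =>
      (star (q.1 : Matrix (Fin m) (Fin m) ℂ)) *ᵥ q.2 := by
  refine measurable_pi_lambda _ fun i => ?_
  simp only [Matrix.mulVec, dotProduct, Matrix.star_apply]
  refine Finset.measurable_sum _ fun k _ => ?_
  refine Measurable.mul ?_ ((measurable_pi_apply k).comp measurable_snd)
  exact (continuous_star.measurable.comp (measurable_unitary_entry k i)).comp measurable_fst

lemma measurable_mulVec {m : ℕ} (W : Matrix (Fin m) (Fin m) ℂ) :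
    Measurable fun g : Fin m → ℂ => W *ᵥ g := by
  refine measurable_pi_lambda _ fun i => ?_
  simp only [Matrix.mulVec, dotProduct]
  exact Finset.measurable_sum _ fun k _ => (measurable_pi_apply k).const_mul _

lemma measurable_mulVec_single {m : ℕ} (p : Fin m) :
    Measurable fun U : Matrix.unitaryGroup (Fin m) ℂ =>
      (U : Matrix (Fin m) (Fin m) ℂ) *ᵥ Pi.single p 1 := by
  refine measurable_pi_lambda _ fun i => ?_
  simp only [Matrix.mulVec_single_one, Matrix.col_apply]
  exact measurable_unitary_entry i p

/-- The integral of a homogeneous function of degree zero against a unitarily invariant measure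
equals its average over the unitary group, up to the total mass. -/
lemma lintegral_eq_of_unitary_invariant {m : ℕ} (p : Fin m)
    (κ : Measure (Matrix.unitaryGroup (Fin m) ℂ)) [SFinite κ]
    (hκ : ∀ W : Matrix.unitaryGroup (Fin m) ℂ, κ.map (fun U => W * U) = κ)
    (τ : Measure (Fin m → ℂ)) [SFinite τ] (hτ0 : τ {0} = 0)
    (hτ : ∀ W : Matrix.unitaryGroup (Fin m) ℂ,
      τ.map (fun g => (W : Matrix (Fin m) (Fin m) ℂ) *ᵥ g) = τ)
    {K : (Fin m → ℂ) → ℝ≥0∞} (hK : Measurable K) (hKc : ∀ (c : ℂ) g, c ≠ 0 → K (c • g) = K g) :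
    κ Set.univ * ∫⁻ g, K g ∂τ = τ Set.univ *
      ∫⁻ U, K (star (U : Matrix (Fin m) (Fin m) ℂ) *ᵥ Pi.single p 1) ∂κ := by
  -- The star turns left invariance of `κ` into `A (W *ᵥ g) = A g`. With homogeneity, `A` is
  -- constant off the origin, while by Tonelli its integral against `τ` is the left-hand side.
  set A : (Fin m → ℂ) → ℝ≥0∞ :=
    fun g => ∫⁻ U, K (star (U : Matrix (Fin m) (Fin m) ℂ) *ᵥ g) ∂κ with hA
  have hKm : ∀ g, Measurable fun U : Matrix.unitaryGroup (Fin m) ℂ =>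
      K (star (U : Matrix (Fin m) (Fin m) ℂ) *ᵥ g) := by
    intro g
    have h1 : Measurable fun U : Matrix.unitaryGroup (Fin m) ℂ => (U, g) :=
      measurable_prodMk_right
    have h2 := measurable_star_mulVec.comp h1
    exact hK.comp h2
  have hAinv : ∀ (W : Matrix.unitaryGroup (Fin m) ℂ) g,
      A ((W : Matrix (Fin m) (Fin m) ℂ) *ᵥ g) = A g := by
    intro W g
    simp only [hA]
    conv_lhs => rw [← hκ W]
    rw [lintegral_map _ (measurable_unitary_mul_left W)]
    · refine lintegral_congr fun U => ?_
      rw [Matrix.mulVec_mulVec]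
      congr 2
      have : star (W : Matrix (Fin m) (Fin m) ℂ) * (W : Matrix (Fin m) (Fin m) ℂ) = 1 :=
        Matrix.mem_unitaryGroup_iff'.mp W.2
      rw [Submonoid.coe_mul, star_mul, mul_assoc, this, mul_one]
    · exact hKm _
  have hAconst : ∀ g, g ≠ 0 → A g = A (Pi.single p 1) := by
    intro g hg
    obtain ⟨W, c, hc, hW⟩ := exists_unitary_mulVec_single hg p
    rw [← hAinv W (Pi.single p 1), hW]
    simp only [hA, Matrix.mulVec_smul]
    exact lintegral_congr fun U => (hKc c _ hc).symm
  calc κ Set.univ * ∫⁻ g, K g ∂τ = ∫⁻ _, ∫⁻ g, K g ∂τ ∂κ := by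
        rw [lintegral_const, mul_comm]
    _ = ∫⁻ U, ∫⁻ g, K (star (U : Matrix (Fin m) (Fin m) ℂ) *ᵥ g) ∂τ ∂κ := by
        refine lintegral_congr fun U => ?_
        have := hτ (star U)
        conv_lhs => rw [← this]
        rw [lintegral_map hK (measurable_mulVec _)]
        rfl
    _ = ∫⁻ g, A g ∂τ :=
        lintegral_lintegral_swap (hK.comp measurable_star_mulVec).aemeasurable
    _ = ∫⁻ _, A (Pi.single p 1) ∂τ := by
        refine lintegral_congr_ae ?_
        have : ∀ᵐ g ∂τ, g ≠ 0 := by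
          rw [ae_iff]; simpa using hτ0
        filter_upwards [this] with g hg using hAconst g hg
    _ = _ := by rw [lintegral_const, mul_comm]

/-- The real determinant of a complex linear map is the squared modulus of its complex determinant,
here `1`. -/
lemma map_mulVec_volume {m : ℕ} (W : Matrix.unitaryGroup (Fin m) ℂ) :
    (volume : Measure (Fin m → ℂ)).map (fun g => (W : Matrix (Fin m) (Fin m) ℂ) *ᵥ g) =
      volume := by
  set f : (Fin m → ℂ) →ₗ[ℂ] (Fin m → ℂ) := Matrix.toLin' (W : Matrix (Fin m) (Fin m) ℂ) with hf
  have h1 : |LinearMap.det (f.restrictScalars ℝ)| = 1 := by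
    rw [LinearMap.det_restrictScalars, hf, LinearMap.det_toLin', Algebra.norm_complex_apply]
    have := (Matrix.det_of_mem_unitary W.2)
    have h2 : ‖(W : Matrix (Fin m) (Fin m) ℂ).det‖ = 1 := CStarRing.norm_of_mem_unitary this
    rw [Complex.normSq_eq_norm_sq, h2]
    norm_num
  have h0 : LinearMap.det (f.restrictScalars ℝ) ≠ 0 := by
    intro h; rw [h] at h1; simp at h1
  have := Measure.map_linearMap_addHaar_eq_smul_addHaar (volume : Measure (Fin m → ℂ)) h0
  have hfun : (fun g => (W : Matrix (Fin m) (Fin m) ℂ) *ᵥ g) = f.restrictScalars ℝ := by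
    funext g
    simp [hf]
  rw [abs_inv, h1, inv_one, ENNReal.ofReal_one, one_smul] at this
  rw [hfun, this]

/-! ### Squared moduli of Lebesgue-distributed complex vectors -/

/-- The pushforward of Lebesgue measure on the complex plane under the squared norm. -/
lemma map_norm_sq_volume :
    (volume : Measure ℂ).map (fun z => ‖z‖ ^ 2) =
      ENNReal.ofReal Real.pi • volume.restrict (Set.Ioi (0 : ℝ)) := by
  refine Measure.ext_of_lintegral _ fun f hf => ?_
  rw [lintegral_map hf (by fun_prop), ← Complex.lintegral_comp_polarCoord_symm,
    lintegral_smul_measure]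
  have him : (fun r : ℝ => r ^ 2) '' Set.Ioi 0 = Set.Ioi 0 := by
    ext s
    constructor
    · rintro ⟨r, hr, rfl⟩
      exact pow_pos (Set.mem_Ioi.mp hr) 2
    · intro hs
      exact ⟨√s, Real.sqrt_pos.mpr hs, Real.sq_sqrt (le_of_lt hs)⟩
  have hinj : Set.InjOn (fun r : ℝ => r ^ 2) (Set.Ioi 0) := by
    intro a ha b hb h
    exact (pow_left_inj₀ (le_of_lt ha) (le_of_lt hb) two_ne_zero).mp h
  -- With `s = r ^ 2` the radial measure `2π r dr` becomes `π ds`.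
  have h1 := lintegral_image_eq_lintegral_abs_deriv_mul (f := fun r : ℝ => r ^ 2)
    (f' := fun r => 2 * r) measurableSet_Ioi
    (fun r _ => by simpa using (hasDerivAt_pow 2 r).hasDerivWithinAt) hinj f
  rw [him] at h1
  simp only [Complex.norm_polarCoord_symm, smul_eq_mul, sq_abs]
  have hm : Measurable fun q : ℝ × ℝ => ENNReal.ofReal q.1 * f (q.1 ^ 2) :=
    (ENNReal.measurable_ofReal.comp measurable_fst).mul (hf.comp (measurable_fst.pow_const 2))
  rw [h1, polarCoord_target, Measure.volume_eq_prod, ← Measure.prod_restrict,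
    lintegral_prod _ hm.aemeasurable]
  simp only [lintegral_const,
    Measure.restrict_apply MeasurableSet.univ, Set.univ_inter, Real.volume_Ioo]
  rw [← lintegral_const_mul' _ _ ENNReal.ofReal_ne_top]
  refine setLIntegral_congr_fun measurableSet_Ioi fun r hr => ?_
  have hr0 : (0 : ℝ) < r := hr
  rw [abs_of_pos (by positivity), ENNReal.ofReal_mul (by norm_num), sub_neg_eq_add, ← two_mul,
    ENNReal.ofReal_mul (by norm_num)]
  ring

lemma pi_const_smul {m : ℕ} (c : ℝ≥0∞) (hc : c ≠ ⊤) (μ : Measure ℝ) [SigmaFinite μ] :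
    Measure.pi (fun _ : Fin m => c • μ) = c ^ m • Measure.pi fun _ : Fin m => μ := by
  have : SigmaFinite (c • μ) := by
    lift c to NNReal using hc
    exact inferInstanceAs (SigmaFinite (c • μ))
  refine (Measure.pi_eq fun s _ => ?_)
  simp [Measure.pi_pi, Finset.prod_mul_distrib]

lemma map_norm_sq_pi_volume {m : ℕ} :
    (volume : Measure (Fin m → ℂ)).map (fun g i => ‖g i‖ ^ 2) =
      ENNReal.ofReal Real.pi ^ m • volume.restrict {t : Fin m → ℝ | ∀ i, 0 < t i} := by
  have h1 : SigmaFinite ((volume : Measure ℂ).map (fun z => ‖z‖ ^ 2)) := by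
    rw [map_norm_sq_volume]
    exact inferInstanceAs (SigmaFinite (Real.toNNReal Real.pi • _))
  have h2 := Measure.pi_map_pi (μ := fun _ : Fin m => (volume : Measure ℂ))
    (f := fun _ z => ‖z‖ ^ 2) (fun _ => by fun_prop)
  rw [volume_pi, h2, map_norm_sq_volume, pi_const_smul _ ENNReal.ofReal_ne_top, volume_pi]
  congr 1
  rw [← Measure.restrict_pi_pi]
  congr 1
  ext t
  simp

/-! ### Measurability of the squared singular values -/

lemma ofReal_charValues_squaredSingularValues {m n : ℕ} (A : Matrix (Fin m) (Fin n) ℂ) (t : ℕ) :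
    ((charValues (squaredSingularValues A) t : ℝ) : ℂ) =
      (Matrix.scalar (Fin n) (t : ℂ) - Aᴴ * A).det := by
  rw [← Matrix.eval_charpoly, (Matrix.isHermitian_conjTranspose_mul_self A).charpoly_eq,
    Polynomial.eval_prod]
  simp [charValues, squaredSingularValues]

lemma measurable_squaredSingularValues {m n : ℕ} :
    Measurable (squaredSingularValues (m := m) (n := n)) := by
  set τ : Fin n ≃ Fin (Fintype.card (Fin n)) := (Fintype.equivOfCardEq (Fintype.card_fin _)).symm
  have hτ : ∀ A : Matrix (Fin m) (Fin n) ℂ, ∀ i, squaredSingularValues A i =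
      (Matrix.isHermitian_conjTranspose_mul_self A).eigenvalues₀ (τ i) := fun A i => rfl
  -- The eigenvalues are listed in decreasing order through a reindexing that does not depend on
  -- `A`, so one permutation sorts them for all `A`.
  set ρ : Equiv.Perm (Fin n) :=
    (Fin.revPerm.trans (finCongr (Fintype.card_fin n).symm)).trans τ.symm with hρ
  refine measurable_of_charValues ρ ?_ ?_
  · intro A i j hij
    simp only [Function.comp_apply, hτ]
    apply (Matrix.isHermitian_conjTranspose_mul_self A).eigenvalues₀_antitone
    simp [hρ, Fin.le_def]
    have := Fin.le_def.mp hij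
    omega
  · rw [measurable_pi_iff]
    intro t
    have h1 : ∀ A : Matrix (Fin m) (Fin n) ℂ, charValues (squaredSingularValues A) t =
        ((Matrix.scalar (Fin n) (t : ℂ) - Aᴴ * A).det).re := by
      intro A
      rw [← ofReal_charValues_squaredSingularValues, Complex.ofReal_re]
    simp only [h1]
    refine Complex.measurable_re.comp ?_
    simp only [Matrix.det_apply]
    refine Finset.measurable_sum _ fun σ _ => Measurable.const_smul ?_ _
    refine Finset.measurable_prod _ fun i _ => ?_
    simp only [Matrix.sub_apply, Matrix.mul_apply, Matrix.conjTranspose_apply]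
    refine Measurable.const_sub ?_ _
    refine Finset.measurable_sum _ fun k _ => Measurable.mul ?_ (measurable_matrix_entry _ _)
    exact continuous_star.measurable.comp (measurable_matrix_entry _ _)

/-! ### The characteristic polynomial after removal of a column -/

/-- The values at the natural numbers of `∑ i, w i ∏ k ≠ i, (z - x k)`, divided by `∑ i, w i`. -/
noncomputable def secularValues {n : ℕ} (x w : Fin (n + 1) → ℝ) : ℕ → ℝ :=
  fun z => (∑ i, w i * ∏ k ∈ Finset.univ.erase i, ((z : ℝ) - x k)) / ∑ i, w i

lemma measurable_secularValues {n : ℕ} :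
    Measurable fun q : (Fin (n + 1) → ℝ) × (Fin (n + 1) → ℝ) => secularValues q.1 q.2 := by
  unfold secularValues
  fun_prop

lemma secularValues_comp_perm {n : ℕ} (x w : Fin (n + 1) → ℝ) (σ : Equiv.Perm (Fin (n + 1))) :
    secularValues (x ∘ σ) (w ∘ σ) = secularValues x w := by
  funext z
  unfold secularValues
  congr 1
  · rw [← Equiv.sum_comp σ (fun i => w i * ∏ k ∈ Finset.univ.erase i, ((z : ℝ) - x k))]
    refine Finset.sum_congr rfl fun i _ => ?_
    simp only [Function.comp_apply]
    congr 1
    refine Finset.prod_bij (fun k _ => σ k) (by simp) (by simp) ?_ (by simp)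
    intro b hb
    refine ⟨σ.symm b, ?_, by simp⟩
    simp only [Finset.mem_erase, Finset.mem_univ, and_true] at hb ⊢
    intro h
    apply hb
    rw [← h]
    simp
  · exact Equiv.sum_comp σ w

lemma secularValues_smul {n : ℕ} (x w : Fin (n + 1) → ℝ) {c : ℝ} (hc : c ≠ 0) :
    secularValues x (fun i => c * w i) = secularValues x w := by
  funext z
  unfold secularValues
  simp only [mul_assoc, ← Finset.mul_sum]
  rw [mul_div_mul_left _ _ hc]

lemma adjugate_eq_det_smul_star {m : ℕ} {Q : Matrix (Fin m) (Fin m) ℂ}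
    (hQ : Q ∈ Matrix.unitaryGroup (Fin m) ℂ) : Q.adjugate = Q.det • star Q := by
  have h1 : Q * star Q = 1 := Matrix.mem_unitaryGroup_iff.mp hQ
  calc Q.adjugate = Q.adjugate * (Q * star Q) := by rw [h1, mul_one]
    _ = Q.det • star Q := by
      rw [← mul_assoc, Matrix.adjugate_mul, smul_mul_assoc, one_mul]

lemma sum_norm_sq_mulVec {m : ℕ} (W : Matrix.unitaryGroup (Fin m) ℂ) (g : Fin m → ℂ) :
    ∑ i, ‖((W : Matrix (Fin m) (Fin m) ℂ) *ᵥ g) i‖ ^ 2 = ∑ i, ‖g i‖ ^ 2 := by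
  have h : ∀ v : Fin m → ℂ, ((∑ i, ‖v i‖ ^ 2 : ℝ) : ℂ) = star v ⬝ᵥ v := by
    intro v
    simp only [dotProduct, Pi.star_apply, Complex.ofReal_sum]
    refine Finset.sum_congr rfl fun i _ => ?_
    rw [RCLike.star_def, Complex.conj_mul', Complex.ofReal_pow]
  apply Complex.ofReal_injective
  rw [h, h, Matrix.star_mulVec, Matrix.dotProduct_mulVec, Matrix.vecMul_vecMul]
  have : ((W : Matrix (Fin m) (Fin m) ℂ))ᴴ * (W : Matrix (Fin m) (Fin m) ℂ) = 1 :=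
    Matrix.mem_unitaryGroup_iff'.mp W.2
  rw [this, Matrix.vecMul_one]

lemma sum_norm_sq_single {m : ℕ} (p : Fin m) :
    ∑ i, ‖(Pi.single p 1 : Fin m → ℂ) i‖ ^ 2 = 1 := by
  rw [Finset.sum_eq_single p] <;> simp +contextual

/-- The principal minors of `t - Q⋆ diag(x) Q` for unitary `Q`. -/
lemma det_submatrix_succAbove_conj_diagonal {n : ℕ} {Q : Matrix (Fin (n + 1)) (Fin (n + 1)) ℂ}
    (hQ : Q ∈ Matrix.unitaryGroup (Fin (n + 1)) ℂ) (d : Fin (n + 1) → ℂ) (p : Fin (n + 1)) :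
    ((star Q * Matrix.diagonal d * Q).submatrix p.succAbove p.succAbove).det =
      ∑ i, ((‖Q i p‖ ^ 2 : ℝ) : ℂ) * ∏ k ∈ Finset.univ.erase i, d k := by
  have h1 := Matrix.adjugate_fin_succ_eq_det_submatrix (star Q * Matrix.diagonal d * Q) p p
  rw [← two_mul, pow_mul, neg_one_sq, one_pow, one_mul] at h1
  have hQ' : star Q ∈ Matrix.unitaryGroup (Fin (n + 1)) ℂ := Unitary.star_mem hQ
  have hdet : Q.det * (star Q).det = 1 := by
    rw [← Matrix.det_mul, Matrix.mem_unitaryGroup_iff.mp hQ, Matrix.det_one]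
  rw [← h1, Matrix.adjugate_mul_distrib, Matrix.adjugate_mul_distrib, Matrix.adjugate_diagonal,
    adjugate_eq_det_smul_star hQ, adjugate_eq_det_smul_star hQ', star_star, smul_mul_assoc,
    Matrix.mul_smul, Matrix.mul_smul, smul_smul, hdet, one_smul, Matrix.mul_apply]
  refine Finset.sum_congr rfl fun i _ => ?_
  rw [Matrix.diagonal_mul, Matrix.star_apply, mul_comm, mul_assoc, mul_comm, mul_assoc]
  have : star (Q i p) * Q i p = ((‖Q i p‖ ^ 2 : ℝ) : ℂ) := by
    rw [RCLike.star_def, Complex.conj_mul', Complex.ofReal_pow]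
  rw [← this]
  ring

/-- With `Q = V⋆ U`, the Gram matrix of `X * U` is `Q⋆ diag(x) Q`, and removing a column passes to a
principal submatrix. The weights come from a column of the unitary `Q`, so the normalizing
denominator is `1`. -/
lemma charValues_corner {m n : ℕ} (X : Matrix (Fin m) (Fin (n + 1)) ℂ)
    (U : Matrix.unitaryGroup (Fin (n + 1)) ℂ) (p : Fin (n + 1)) :
    charValues (squaredSingularValues
      ((X * (U : Matrix (Fin (n + 1)) (Fin (n + 1)) ℂ)).submatrix id p.succAbove)) =
    secularValues (squaredSingularValues X) fun i => ‖(((star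
      (Matrix.isHermitian_conjTranspose_mul_self X).eigenvectorUnitary * U :
      Matrix.unitaryGroup (Fin (n + 1)) ℂ) : Matrix (Fin (n + 1)) (Fin (n + 1)) ℂ) *ᵥ
      Pi.single p 1) i‖ ^ 2 := by
  set hX := Matrix.isHermitian_conjTranspose_mul_self X
  set Q : Matrix.unitaryGroup (Fin (n + 1)) ℂ := star hX.eigenvectorUnitary * U with hQ
  funext t
  apply Complex.ofReal_injective
  rw [ofReal_charValues_squaredSingularValues]
  have hsum : ∑ i, ‖((Q : Matrix (Fin (n + 1)) (Fin (n + 1)) ℂ) *ᵥ Pi.single p 1) i‖ ^ 2 = 1 := by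
    rw [sum_norm_sq_mulVec, sum_norm_sq_single]
  have hspec : Xᴴ * X = (hX.eigenvectorUnitary : Matrix (Fin (n + 1)) (Fin (n + 1)) ℂ) *
      Matrix.diagonal (fun i => ((squaredSingularValues X i : ℝ) : ℂ)) *
      star (hX.eigenvectorUnitary : Matrix (Fin (n + 1)) (Fin (n + 1)) ℂ) := by
    have := hX.spectral_theorem
    rw [Unitary.conjStarAlgAut_apply] at this
    exact this
  have hmat : Matrix.scalar (Fin n) (t : ℂ) -
      ((X * (U : Matrix (Fin (n + 1)) (Fin (n + 1)) ℂ)).submatrix id p.succAbove)ᴴ *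
        ((X * (U : Matrix (Fin (n + 1)) (Fin (n + 1)) ℂ)).submatrix id p.succAbove) =
      (star (Q : Matrix (Fin (n + 1)) (Fin (n + 1)) ℂ) *
        Matrix.diagonal (fun i => (t : ℂ) - ((squaredSingularValues X i : ℝ) : ℂ)) *
        (Q : Matrix (Fin (n + 1)) (Fin (n + 1)) ℂ)).submatrix p.succAbove p.succAbove := by
    have h1 : star (Q : Matrix (Fin (n + 1)) (Fin (n + 1)) ℂ) *
        Matrix.diagonal (fun i => (t : ℂ) - ((squaredSingularValues X i : ℝ) : ℂ)) *
        (Q : Matrix (Fin (n + 1)) (Fin (n + 1)) ℂ) = Matrix.scalar (Fin (n + 1)) (t : ℂ) -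
        (X * (U : Matrix (Fin (n + 1)) (Fin (n + 1)) ℂ))ᴴ *
          (X * (U : Matrix (Fin (n + 1)) (Fin (n + 1)) ℂ)) := by
      have h2 : Matrix.diagonal (fun i => (t : ℂ) - ((squaredSingularValues X i : ℝ) : ℂ)) =
          (t : ℂ) • (1 : Matrix (Fin (n + 1)) (Fin (n + 1)) ℂ) -
            Matrix.diagonal (fun i => ((squaredSingularValues X i : ℝ) : ℂ)) := by
        rw [Matrix.smul_one_eq_diagonal, Matrix.diagonal_sub]
      rw [h2, mul_sub, sub_mul, Matrix.mul_smul, mul_one, Matrix.smul_mul,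
        Matrix.mem_unitaryGroup_iff'.mp Q.2, Matrix.conjTranspose_mul]
      congr 1
      · rw [Matrix.scalar_apply, Matrix.smul_one_eq_diagonal]
      · rw [Matrix.mul_assoc (U : Matrix (Fin (n + 1)) (Fin (n + 1)) ℂ)ᴴ, ← Matrix.mul_assoc Xᴴ,
          hspec, hQ]
        simp only [Submonoid.coe_mul, Unitary.coe_star, star_mul, Matrix.conjTranspose_conjTranspose,
          Matrix.star_eq_conjTranspose, mul_assoc]
    rw [h1, Matrix.submatrix_sub]
    congr 1
    simp only [Matrix.scalar_apply]
    exact (Matrix.submatrix_diagonal (fun _ => (t : ℂ)) p.succAbove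
      Fin.succAbove_right_injective).symm
  rw [hmat, det_submatrix_succAbove_conj_diagonal Q.2]
  simp only [secularValues, hsum, div_one]
  push_cast
  simp

/-! ### Haar averages as averages over the simplex of weights -/

/-- The average of a function of the interpolated polynomial over the simplex of weights. -/
noncomputable def simplexAverage {n : ℕ} (H : (ℕ → ℝ) → ℝ≥0∞) (x : Fin (n + 1) → ℝ) : ℝ≥0∞ :=
  ∫⁻ w in {w : Fin (n + 1) → ℝ | (∀ i, 0 < w i) ∧ ∑ i, w i ≤ 1}, H (secularValues x w)

lemma measurableSet_pos {m : ℕ} : MeasurableSet {w : Fin m → ℝ | ∀ i, 0 < w i} := by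
  have : {w : Fin m → ℝ | ∀ i, 0 < w i} = Set.univ.pi fun _ => Set.Ioi 0 := by ext; simp
  rw [this]
  exact MeasurableSet.univ_pi fun _ => measurableSet_Ioi

lemma measurableSet_sum_le_one {m : ℕ} : MeasurableSet {w : Fin m → ℝ | ∑ i, w i ≤ 1} :=
  measurableSet_le (by fun_prop) measurable_const

lemma measurable_simplexAverage {n : ℕ} {H : (ℕ → ℝ) → ℝ≥0∞} (hH : Measurable H) :
    Measurable (simplexAverage (n := n) H) :=
  Measurable.lintegral_prod_right' (hH.comp measurable_secularValues)

lemma simplexAverage_comp_perm {n : ℕ} (H : (ℕ → ℝ) → ℝ≥0∞) (x : Fin (n + 1) → ℝ)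
    (σ : Equiv.Perm (Fin (n + 1))) : simplexAverage H (x ∘ σ) = simplexAverage H x := by
  unfold simplexAverage
  have h := (measurePreserving_comp_perm σ).setLIntegral_comp_preimage_emb
    (measurableEmbedding_comp_perm σ) (fun w => H (secularValues (x ∘ σ) w))
    {w : Fin (n + 1) → ℝ | (∀ i, 0 < w i) ∧ ∑ i, w i ≤ 1}
  rw [← h]
  simp only [secularValues_comp_perm]
  congr 2
  ext w
  simp only [Set.preimage_ofPred_eq, Set.mem_ofPred_eq, Function.comp_apply]
  rw [Equiv.sum_comp σ w]
  exact and_congr_left fun _ => ⟨fun h i => by simpa using h (σ.symm i), fun h i => h _⟩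

/-- The law `τ` of a Haar column and Lebesgue measure `γ` on the unit ball are both unitarily
invariant, so they agree, up to mass, on functions of degree zero. Squared moduli carry the ball to
the simplex with a factor `π` per coordinate, whence `c = π ^ (n + 1) / volume B`, independent of
`X` and `H`. -/
lemma lintegral_haar_corner {n : ℕ} (κ : Measure (Matrix.unitaryGroup (Fin (n + 1)) ℂ))
    [IsProbabilityMeasure κ]
    (hκ : ∀ W : Matrix.unitaryGroup (Fin (n + 1)) ℂ, κ.map (fun U => W * U) = κ)
    (p : Fin (n + 1)) :
    ∃ c : ℝ≥0∞, c ≠ 0 ∧ c ≠ ⊤ ∧ ∀ (m : ℕ) (X : Matrix (Fin m) (Fin (n + 1)) ℂ)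
      (H : (ℕ → ℝ) → ℝ≥0∞), Measurable H →
      ∫⁻ U, H (charValues (squaredSingularValues
        ((X * (U : Matrix (Fin (n + 1)) (Fin (n + 1)) ℂ)).submatrix id p.succAbove))) ∂κ =
      c * simplexAverage H (squaredSingularValues X) := by
  set B : Set (Fin (n + 1) → ℂ) := {g | ∑ i, ‖g i‖ ^ 2 ≤ 1} with hB
  have hBm : MeasurableSet B := measurableSet_le (by fun_prop) measurable_const
  have hBtop : volume B ≠ ⊤ := by
    refine ((measure_mono ?_).trans_lt (measure_closedBall_lt_top (x := 0) (r := 1))).ne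
    intro g hg
    rw [mem_closedBall_zero_iff, pi_norm_le_iff_of_nonneg zero_le_one]
    intro i
    have h1 : ‖g i‖ ^ 2 ≤ ∑ i, ‖g i‖ ^ 2 :=
      Finset.single_le_sum (f := fun i => ‖g i‖ ^ 2) (fun _ _ => by positivity)
        (Finset.mem_univ i)
    have h2 : ‖g i‖ ^ 2 ≤ 1 := h1.trans hg
    exact (sq_le_one_iff₀ (norm_nonneg _)).mp h2
  have hB0 : volume B ≠ 0 := by
    have ho : IsOpen {g : Fin (n + 1) → ℂ | ∑ i, ‖g i‖ ^ 2 < 1} :=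
      isOpen_lt (by fun_prop) continuous_const
    have hne : {g : Fin (n + 1) → ℂ | ∑ i, ‖g i‖ ^ 2 < 1}.Nonempty := ⟨0, by simp⟩
    intro h
    have hsub : {g : Fin (n + 1) → ℂ | ∑ i, ‖g i‖ ^ 2 < 1} ⊆ B := by
      intro g hg
      exact (show ∑ i, ‖g i‖ ^ 2 < 1 from hg).le
    exact (ho.measure_pos volume hne).ne' (measure_mono_null hsub h)
  set γ : Measure (Fin (n + 1) → ℂ) := volume.restrict B with hγ
  set τ : Measure (Fin (n + 1) → ℂ) :=
    κ.map (fun U : Matrix.unitaryGroup (Fin (n + 1)) ℂ => (U : Matrix (Fin (n + 1)) (Fin (n + 1)) ℂ) *ᵥ Pi.single p 1) with hτ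
  have hτp : IsProbabilityMeasure τ :=
    Measure.isProbabilityMeasure_map (measurable_mulVec_single p).aemeasurable
  have hτ0 : τ {0} = 0 := by
    rw [hτ, Measure.map_apply (measurable_mulVec_single p) (measurableSet_singleton 0)]
    convert measure_empty (μ := κ)
    ext U
    simp only [Set.mem_preimage, Set.mem_singleton_iff, Set.mem_empty_iff_false, iff_false]
    intro h
    have := sum_norm_sq_mulVec U (Pi.single p 1)
    rw [h, sum_norm_sq_single] at this
    simp at this
  have hτinv : ∀ W : Matrix.unitaryGroup (Fin (n + 1)) ℂ,
      τ.map (fun g => (W : Matrix (Fin (n + 1)) (Fin (n + 1)) ℂ) *ᵥ g) = τ := by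
    intro W
    rw [hτ, Measure.map_map (measurable_mulVec _) (measurable_mulVec_single p)]
    conv_rhs => rw [← hκ W]
    rw [Measure.map_map (measurable_mulVec_single p) (measurable_unitary_mul_left W)]
    congr 1
    funext U
    exact Matrix.mulVec_mulVec _ _ _
  have hγ0 : γ {0} = 0 := by
    refine le_antisymm ((Measure.restrict_apply_le _ _).trans ?_) zero_le
    simp
  have hγinv : ∀ W : Matrix.unitaryGroup (Fin (n + 1)) ℂ,
      γ.map (fun g => (W : Matrix (Fin (n + 1)) (Fin (n + 1)) ℂ) *ᵥ g) = γ := by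
    intro W
    have hpre : (fun g => (W : Matrix (Fin (n + 1)) (Fin (n + 1)) ℂ) *ᵥ g) ⁻¹' B = B := by
      ext g
      simp only [hB, Set.mem_preimage, Set.mem_ofPred_eq, sum_norm_sq_mulVec]
    have := Measure.restrict_map (μ := volume) (measurable_mulVec
      (W : Matrix (Fin (n + 1)) (Fin (n + 1)) ℂ)) hBm
    rw [map_mulVec_volume, hpre] at this
    exact this.symm
  refine ⟨(volume B)⁻¹ * ENNReal.ofReal Real.pi ^ (n + 1), ?_, ?_, ?_⟩
  · refine mul_ne_zero (ENNReal.inv_ne_zero.mpr hBtop) (pow_ne_zero _ ?_)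
    simpa using Real.pi_pos
  · exact ENNReal.mul_ne_top (ENNReal.inv_ne_top.mpr hB0) (ENNReal.pow_ne_top ENNReal.ofReal_ne_top)
  · intro m X H hH
    set x := squaredSingularValues X with hx
    have hs : Measurable fun w : Fin (n + 1) → ℝ => secularValues x w :=
      measurable_secularValues.comp measurable_prodMk_left
    have hsq : Measurable fun (g : Fin (n + 1) → ℂ) i => ‖g i‖ ^ 2 := by fun_prop
    set K : (Fin (n + 1) → ℂ) → ℝ≥0∞ := fun g => H (secularValues x fun i => ‖g i‖ ^ 2) with hK
    have hKm : Measurable K := hH.comp (hs.comp hsq)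
    have hKc : ∀ (c : ℂ) g, c ≠ 0 → K (c • g) = K g := by
      intro c g hc
      simp only [hK, Pi.smul_apply, smul_eq_mul, norm_mul, mul_pow]
      rw [secularValues_smul]
      positivity
    -- Both integrals are compared with the same group average.
    have h1 := lintegral_eq_of_unitary_invariant p κ hκ τ hτ0 hτinv hKm hKc
    have h2 := lintegral_eq_of_unitary_invariant p κ hκ γ hγ0 hγinv hKm hKc
    rw [measure_univ, one_mul, measure_univ, one_mul] at h1
    rw [measure_univ, one_mul, ← h1, hγ, Measure.restrict_apply_univ] at h2
    simp only [charValues_corner]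
    have h3 : ∫⁻ U, H (secularValues x fun i => ‖(((star
      (Matrix.isHermitian_conjTranspose_mul_self X).eigenvectorUnitary * U :
      Matrix.unitaryGroup (Fin (n + 1)) ℂ) : Matrix (Fin (n + 1)) (Fin (n + 1)) ℂ) *ᵥ
      Pi.single p 1) i‖ ^ 2) ∂κ = ∫⁻ g, K g ∂τ := by
      rw [hτ, lintegral_map hKm (measurable_mulVec_single p)]
      -- For fixed `X`, left invariance absorbs its eigenvector matrix.
      conv_rhs => rw [← hκ (star (Matrix.isHermitian_conjTranspose_mul_self X).eigenvectorUnitary)]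
      exact (lintegral_map (hKm.comp (measurable_mulVec_single p))
        (measurable_unitary_mul_left _)).symm
    rw [h3]
    have h4 : ∫⁻ g in B, K g = ENNReal.ofReal Real.pi ^ (n + 1) * simplexAverage H x := by
      set F : (Fin (n + 1) → ℝ) → ℝ≥0∞ :=
        {w : Fin (n + 1) → ℝ | ∑ i, w i ≤ 1}.indicator fun w => H (secularValues x w) with hF
      have hFm : Measurable F := (hH.comp hs).indicator measurableSet_sum_le_one
      have h5 : ∫⁻ g in B, K g = ∫⁻ g : Fin (n + 1) → ℂ, F fun i => ‖g i‖ ^ 2 := by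
        rw [← lintegral_indicator hBm]
        rfl
      rw [h5, ← lintegral_map hFm hsq, map_norm_sq_pi_volume, lintegral_smul_measure, smul_eq_mul,
        hF, lintegral_indicator measurableSet_sum_le_one,
        Measure.restrict_restrict measurableSet_sum_le_one, simplexAverage]
      congr 3
      ext w
      simp [and_comm]
    rw [mul_assoc, ← h4, h2, ← mul_assoc, ENNReal.inv_mul_cancel hB0 hBtop, one_mul]

/-! ### Change of variables from weights to roots -/

/-- The polynomial with roots `y` and leading coefficient one. -/
noncomputable def rootPolynomial {n : ℕ} (y : Fin n → ℝ) : Polynomial ℝ :=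
  ∏ j, (Polynomial.X - Polynomial.C (y j))

/-- The polynomial `∑ i, w i ∏ k ≠ i, (z - x k)`. -/
noncomputable def secularPolynomial {n : ℕ} (x w : Fin (n + 1) → ℝ) : Polynomial ℝ :=
  ∑ i, Polynomial.C (w i) * ∏ j, (Polynomial.X - Polynomial.C (x (i.succAbove j)))

lemma prod_erase_eq_prod_succAbove {n : ℕ} (i : Fin (n + 1)) (f : Fin (n + 1) → ℝ) :
    ∏ k ∈ Finset.univ.erase i, f k = ∏ j, f (i.succAbove j) := by
  rw [← Finset.compl_singleton, ← Fin.image_succAbove_univ,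
    Finset.prod_image fun a _ b _ h => Fin.succAbove_right_injective h]

lemma rootPolynomial_monic {n : ℕ} (y : Fin n → ℝ) : (rootPolynomial y).Monic :=
  Polynomial.monic_prod_X_sub_C _ _

lemma rootPolynomial_natDegree {n : ℕ} (y : Fin n → ℝ) : (rootPolynomial y).natDegree = n := by
  simp [rootPolynomial]

lemma rootPolynomial_coeff {n : ℕ} (y : Fin n → ℝ) : (rootPolynomial y).coeff n = 1 := by
  have := rootPolynomial_monic y
  rwa [Polynomial.Monic, Polynomial.leadingCoeff, rootPolynomial_natDegree] at this

lemma rootPolynomial_eval {n : ℕ} (y : Fin n → ℝ) (z : ℝ) :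
    (rootPolynomial y).eval z = ∏ j, (z - y j) := by
  simp [rootPolynomial, Polynomial.eval_prod]

lemma secularPolynomial_eq {n : ℕ} (x w : Fin (n + 1) → ℝ) :
    secularPolynomial x w =
      ∑ i, Polynomial.C (w i) * rootPolynomial fun j => x (i.succAbove j) := rfl

lemma secularPolynomial_natDegree_le {n : ℕ} (x w : Fin (n + 1) → ℝ) :
    (secularPolynomial x w).natDegree ≤ n := by
  rw [secularPolynomial_eq]
  refine Polynomial.natDegree_sum_le_of_forall_le _ _ fun i _ => ?_
  refine (Polynomial.natDegree_C_mul_le _ _).trans ?_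
  rw [rootPolynomial_natDegree]

lemma secularPolynomial_coeff {n : ℕ} (x w : Fin (n + 1) → ℝ) :
    (secularPolynomial x w).coeff n = ∑ i, w i := by
  rw [secularPolynomial_eq]
  simp [rootPolynomial_coeff]

lemma secularPolynomial_eval {n : ℕ} (x w : Fin (n + 1) → ℝ) (z : ℝ) :
    (secularPolynomial x w).eval z = ∑ i, w i * ∏ j, (z - x (i.succAbove j)) := by
  rw [secularPolynomial_eq]
  simp [Polynomial.eval_finsetSum, rootPolynomial_eval]

lemma secularPolynomial_eval_node {n : ℕ} (x w : Fin (n + 1) → ℝ) (i : Fin (n + 1)) :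
    (secularPolynomial x w).eval (x i) = w i * ∏ j, (x i - x (i.succAbove j)) := by
  rw [secularPolynomial_eval, Finset.sum_eq_single i]
  · intro k _ hk
    obtain ⟨j, hj⟩ := Fin.exists_succAbove_eq hk.symm
    rw [Finset.prod_eq_zero (Finset.mem_univ j), mul_zero]
    rw [hj, sub_self]
  · simp

lemma secularValues_eq_eval {n : ℕ} (x w : Fin (n + 1) → ℝ) (z : ℕ) :
    secularValues x w z = (secularPolynomial x w).eval (z : ℝ) / ∑ i, w i := by
  rw [secularPolynomial_eval, secularValues]
  simp only [prod_erase_eq_prod_succAbove _ fun k => (z : ℝ) - x k]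

/-- The weights of the polynomial with leading coefficient `v 0` and roots `v 1, …, v n` in the
Lagrange basis with nodes `x`. -/
noncomputable def lagrangeWeights {n : ℕ} (x v : Fin (n + 1) → ℝ) : Fin (n + 1) → ℝ :=
  fun i => v 0 * ∏ j : Fin n, ((x i - v j.succ) / (x i - x (i.succAbove j)))

lemma prod_node_sub_ne_zero {n : ℕ} {x : Fin (n + 1) → ℝ} (hx : Function.Injective x)
    (i : Fin (n + 1)) : ∏ j, (x i - x (i.succAbove j)) ≠ 0 :=
  Finset.prod_ne_zero_iff.mpr fun j _ => sub_ne_zero.mpr fun h =>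
    Fin.succAbove_ne i j (hx h).symm

/-- Both sides have degree at most `n` and agree at the `n + 1` nodes, where only one term of the
secular sum survives. -/
lemma secularPolynomial_lagrangeWeights {n : ℕ} {x : Fin (n + 1) → ℝ}
    (hx : Function.Injective x) (v : Fin (n + 1) → ℝ) :
    secularPolynomial x (lagrangeWeights x v) =
      Polynomial.C (v 0) * rootPolynomial fun j => v j.succ := by
  refine Polynomial.eq_of_degrees_lt_of_eval_index_eq (Finset.univ : Finset (Fin (n + 1)))
    (v := x) hx.injOn ?_ ?_ ?_
  · rw [Finset.card_univ, Fintype.card_fin]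
    exact Polynomial.degree_le_natDegree.trans_lt (Nat.cast_lt.mpr
      ((secularPolynomial_natDegree_le x _).trans_lt n.lt_succ_self))
  · rw [Finset.card_univ, Fintype.card_fin]
    refine Polynomial.degree_le_natDegree.trans_lt (Nat.cast_lt.mpr
      ((Polynomial.natDegree_C_mul_le _ _).trans_lt ?_))
    rw [rootPolynomial_natDegree]
    exact n.lt_succ_self
  · intro i _
    rw [secularPolynomial_eval_node, Polynomial.eval_mul, Polynomial.eval_C, rootPolynomial_eval,
      lagrangeWeights, Finset.prod_div_distrib, mul_assoc,
      div_mul_cancel₀ _ (prod_node_sub_ne_zero hx i)]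

lemma sum_lagrangeWeights {n : ℕ} {x : Fin (n + 1) → ℝ}
    (hx : Function.Injective x) (v : Fin (n + 1) → ℝ) : ∑ i, lagrangeWeights x v i = v 0 := by
  rw [← secularPolynomial_coeff x, secularPolynomial_lagrangeWeights hx, Polynomial.coeff_C_mul,
    rootPolynomial_coeff, mul_one]

lemma secularValues_lagrangeWeights {n : ℕ} {x : Fin (n + 1) → ℝ} (hx : Function.Injective x)
    {v : Fin (n + 1) → ℝ} (hv : v 0 ≠ 0) :
    secularValues x (lagrangeWeights x v) = charValues fun j => v j.succ := by
  funext z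
  rw [secularValues_eq_eval, sum_lagrangeWeights hx, secularPolynomial_lagrangeWeights hx,
    Polynomial.eval_mul, Polynomial.eval_C, rootPolynomial_eval, mul_div_cancel_left₀ _ hv]
  rfl

/-- The vectors that strictly interlace with `x`. -/
def interlacingSet {n : ℕ} (x : Fin (n + 1) → ℝ) : Set (Fin n → ℝ) :=
  {y | ∀ i : Fin n, x i.castSucc < y i ∧ y i < x i.succ}

lemma strictMono_of_mem_interlacingSet {n : ℕ} {x : Fin (n + 1) → ℝ} {y : Fin n → ℝ}
    (h : y ∈ interlacingSet x) : StrictMono y := by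
  cases n with
  | zero => intro i; exact i.elim0
  | succ n =>
    rw [Fin.strictMono_iff_lt_succ]
    intro i
    have h1 := (h i.castSucc).2
    have h2 := (h i.succ).1
    rw [Fin.succ_castSucc] at h1
    exact h1.trans h2

/-- By interlacing, `y j` and the node `x (i.succAbove j)` lie on the same side of `x i`, so every
quotient is positive. -/
lemma lagrangeWeights_pos {n : ℕ} {x : Fin (n + 1) → ℝ} (hx : StrictMono x)
    {v : Fin (n + 1) → ℝ} (hv : 0 < v 0) (hy : (fun j : Fin n => v j.succ) ∈ interlacingSet x)
    (i : Fin (n + 1)) : 0 < lagrangeWeights x v i := by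
  refine mul_pos hv (Finset.prod_pos fun j _ => ?_)
  have hj := hy j
  rcases lt_or_ge j.castSucc i with h | h
  · rw [Fin.succAbove_of_castSucc_lt _ _ h]
    have h1 : x j.succ ≤ x i := hx.monotone (Fin.castSucc_lt_iff_succ_le.mp h)
    have h2 : x j.castSucc < x i := hx h
    exact div_pos (by linarith [hj.2]) (by linarith)
  · rw [Fin.succAbove_of_le_castSucc _ _ h]
    have h1 : x i ≤ x j.castSucc := hx.monotone h
    have h2 : x j.castSucc < x j.succ := hx (Fin.castSucc_lt_succ)
    exact div_pos_of_neg_of_neg (by linarith [hj.1]) (by linarith)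

/-- Neighbouring nodes lie on the same side of every other node, so those factors pair off
positively. What remains is minus the square of the gap. This is the sign change that forces a root
between neighbouring nodes. -/
lemma prod_node_sub_mul_prod_node_sub_neg {n : ℕ} {x : Fin (n + 1) → ℝ} (hx : StrictMono x)
    (i : Fin n) : (∏ j, (x i.castSucc - x (i.castSucc.succAbove j))) *
      ∏ j, (x i.succ - x (i.succ.succAbove j)) < 0 := by
  rw [← prod_erase_eq_prod_succAbove _ fun k => x i.castSucc - x k,
    ← prod_erase_eq_prod_succAbove _ fun k => x i.succ - x k]
  have hne : i.castSucc ≠ i.succ := (Fin.castSucc_lt_succ).ne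
  rw [← Finset.mul_prod_erase (Finset.univ.erase i.castSucc) _
      (Finset.mem_erase.mpr ⟨hne.symm, Finset.mem_univ _⟩),
    ← Finset.mul_prod_erase (Finset.univ.erase i.succ) _
      (Finset.mem_erase.mpr ⟨hne, Finset.mem_univ _⟩), Finset.erase_right_comm, mul_mul_mul_comm,
    ← Finset.prod_mul_distrib]
  have h0 : x i.castSucc < x i.succ := hx Fin.castSucc_lt_succ
  refine mul_neg_of_neg_of_pos (mul_neg_of_neg_of_pos (by linarith) (by linarith)) ?_
  refine Finset.prod_pos fun k hk => ?_
  simp only [Finset.mem_erase, Finset.mem_univ, and_true] at hk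
  rcases lt_or_gt_of_ne hk.2 with h | h
  · have h1 := hx h
    rcases lt_or_gt_of_ne hk.1 with h' | h'
    · have h2 := hx h'
      exact mul_pos (by linarith) (by linarith)
    · exfalso
      have e1 := Fin.lt_def.mp h
      have e2 := Fin.lt_def.mp h'
      simp at e1 e2
      omega
  · rcases lt_or_gt_of_ne hk.1 with h' | h'
    · exfalso
      have e1 := Fin.lt_def.mp h
      have e2 := Fin.lt_def.mp h'
      simp at e1 e2
      omega
    · have h1 := hx h
      have h2 := hx h'
      exact mul_pos_of_neg_of_neg (by linarith) (by linarith)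

/-- The secular polynomial changes sign in each of the `n` gaps. These roots and its leading
coefficient `∑ i, w i` determine it. -/
lemma exists_lagrangeWeights_eq {n : ℕ} {x : Fin (n + 1) → ℝ} (hx : StrictMono x)
    {w : Fin (n + 1) → ℝ} (hw : ∀ i, 0 < w i) :
    ∃ v : Fin (n + 1) → ℝ, 0 < v 0 ∧ (fun j : Fin n => v j.succ) ∈ interlacingSet x ∧
      lagrangeWeights x v = w := by
  set p := secularPolynomial x w with hp
  have hroot : ∀ i : Fin n, ∃ y, x i.castSucc < y ∧ y < x i.succ ∧ p.eval y = 0 := by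
    intro i
    have hlt : x i.castSucc < x i.succ := hx Fin.castSucc_lt_succ
    have hneg : p.eval (x i.castSucc) * p.eval (x i.succ) < 0 := by
      rw [hp, secularPolynomial_eval_node, secularPolynomial_eval_node, mul_mul_mul_comm]
      exact mul_neg_of_pos_of_neg (mul_pos (hw _) (hw _))
        (prod_node_sub_mul_prod_node_sub_neg hx i)
    have hc : ContinuousOn (fun z => p.eval z) (Set.Icc (x i.castSucc) (x i.succ)) :=
      p.continuous.continuousOn
    rcases mul_neg_iff.mp hneg with ⟨h1, h2⟩ | ⟨h1, h2⟩
    · obtain ⟨y, hy, hy0⟩ := intermediate_value_Ioo' hlt.le hc ⟨h2, h1⟩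
      exact ⟨y, hy.1, hy.2, hy0⟩
    · obtain ⟨y, hy, hy0⟩ := intermediate_value_Ioo hlt.le hc ⟨h1, h2⟩
      exact ⟨y, hy.1, hy.2, hy0⟩
  choose y hy1 hy2 hy0 using hroot
  have hyI : y ∈ interlacingSet x := fun i => ⟨hy1 i, hy2 i⟩
  have hyinj : Function.Injective y := (strictMono_of_mem_interlacingSet hyI).injective
  have hpe : p = Polynomial.C (∑ i, w i) * rootPolynomial y := by
    refine Polynomial.eq_of_degree_sub_lt_of_eval_index_eq (Finset.univ : Finset (Fin n))
      (v := y) hyinj.injOn ?_ ?_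
    · rw [Finset.card_univ, Fintype.card_fin, Polynomial.degree_lt_iff_coeff_zero]
      intro m hm
      rw [Polynomial.coeff_sub, Polynomial.coeff_C_mul]
      rcases hm.eq_or_lt with rfl | hm
      · rw [secularPolynomial_coeff, rootPolynomial_coeff, mul_one, sub_self]
      · rw [Polynomial.coeff_eq_zero_of_natDegree_lt
          ((secularPolynomial_natDegree_le x w).trans_lt hm),
          Polynomial.coeff_eq_zero_of_natDegree_lt (by rwa [rootPolynomial_natDegree]), mul_zero,
          sub_self]
    · intro i _
      rw [hy0, Polynomial.eval_mul, rootPolynomial_eval,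
        Finset.prod_eq_zero (Finset.mem_univ i) (sub_self _), mul_zero]
  refine ⟨Fin.cons (∑ i, w i) y, ?_, ?_, ?_⟩
  · exact Finset.sum_pos (fun i _ => hw i) Finset.univ_nonempty
  · simpa using hyI
  · funext i
    have h1 := congrArg (Polynomial.eval (x i)) hpe
    rw [hp, secularPolynomial_eval_node, Polynomial.eval_mul, Polynomial.eval_C,
      rootPolynomial_eval] at h1
    simp only [lagrangeWeights, Fin.cons_zero, Fin.cons_succ, Finset.prod_div_distrib]
    rw [← mul_div_assoc, ← h1, mul_div_cancel_right₀ _ (prod_node_sub_ne_zero hx.injective i)]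

lemma injOn_lagrangeWeights {n : ℕ} {x : Fin (n + 1) → ℝ} (hx : StrictMono x) :
    Set.InjOn (lagrangeWeights x)
      {v | 0 < v 0 ∧ (fun j : Fin n => v j.succ) ∈ interlacingSet x} := by
  rintro v ⟨hv0, hv⟩ u ⟨hu0, hu⟩ h
  have h0 : v 0 = u 0 := by
    rw [← sum_lagrangeWeights hx.injective v, h, sum_lagrangeWeights hx.injective]
  have h1 : (fun j : Fin n => v j.succ) = fun j => u j.succ := by
    refine eq_of_charValues_eq_of_monotone (strictMono_of_mem_interlacingSet hv).monotone
      (strictMono_of_mem_interlacingSet hu).monotone ?_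
    rw [← secularValues_lagrangeWeights hx.injective hv0.ne', h,
      secularValues_lagrangeWeights hx.injective hu0.ne']
  funext i
  refine Fin.cases h0 (fun j => congrFun h1 j) i

lemma image_lagrangeWeights {n : ℕ} {x : Fin (n + 1) → ℝ} (hx : StrictMono x) :
    lagrangeWeights x '' {v | 0 < v 0 ∧ (fun j : Fin n => v j.succ) ∈ interlacingSet x} =
      {w | ∀ i, 0 < w i} := by
  ext w
  constructor
  · rintro ⟨v, ⟨h0, hv⟩, rfl⟩ i
    exact lagrangeWeights_pos hx h0 hv i
  · intro hw
    obtain ⟨v, h0, hv, rfl⟩ := exists_lagrangeWeights_eq hx hw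
    exact ⟨v, ⟨h0, hv⟩, rfl⟩

/-- Each difference occurs once with either sign. -/
lemma abs_prod_prod_node_sub {n : ℕ} (x : Fin n → ℝ) :
    |∏ i, ∏ k ∈ Finset.univ.erase i, (x i - x k)| = (Matrix.vandermonde x).det ^ 2 := by
  have h1 : ∀ i : Fin n, ∏ k ∈ Finset.univ.erase i, (x i - x k) =
      (∏ k ∈ Finset.Ioi i, (x i - x k)) * ∏ k ∈ Finset.Iio i, (x i - x k) := by
    intro i
    rw [← Finset.prod_union]
    · congr 1
      ext k
      simp only [Finset.mem_erase, Finset.mem_univ, and_true, Finset.mem_union, Finset.mem_Ioi,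
        Finset.mem_Iio]
      exact ⟨fun h => (lt_or_gt_of_ne h).symm, fun h => h.elim (fun h => h.ne') fun h => h.ne⟩
    · rw [Finset.disjoint_left]
      intro k hk hk'
      exact absurd (Finset.mem_Ioi.mp hk) (Finset.mem_Iio.mp hk').not_gt
  have h2 : ∏ i, ∏ k ∈ Finset.Iio i, (x i - x k) = (Matrix.vandermonde x).det := by
    rw [Matrix.det_vandermonde]
    exact Finset.prod_comm' (by simp)
  have h3 : |∏ i, ∏ k ∈ Finset.Ioi i, (x i - x k)| = |(Matrix.vandermonde x).det| := by
    rw [Matrix.det_vandermonde]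
    simp only [Finset.abs_prod, abs_sub_comm]
  simp only [h1, Finset.prod_mul_distrib, abs_mul, h2, h3]
  rw [← abs_mul, ← sq, abs_of_nonneg (sq_nonneg _)]

/-- The Jacobian matrix of `lagrangeWeights x`, up to row and column factors. -/
def rootMatrix {n : ℕ} (x : Fin (n + 1) → ℝ) (y : Fin n → ℝ) :
    Matrix (Fin (n + 1)) (Fin (n + 1)) ℝ :=
  Matrix.of fun i => Fin.cons (∏ j, (x i - y j)) fun j => ∏ l ∈ Finset.univ.erase j, (x i - y l)

/-- The coefficient matrix of the polynomials whose values are in `rootMatrix`. -/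
noncomputable def rootCoeffMatrix {n : ℕ} (y : Fin n → ℝ) :
    Matrix (Fin (n + 1)) (Fin (n + 1)) ℝ :=
  Matrix.of fun m => Fin.cons ((rootPolynomial y).coeff m)
    fun j => (∏ l ∈ Finset.univ.erase j, (Polynomial.X - Polynomial.C (y l))).coeff m

lemma rootMatrix_eq {n : ℕ} (x : Fin (n + 1) → ℝ) (y : Fin n → ℝ) :
    rootMatrix x y = Matrix.vandermonde x * rootCoeffMatrix y := by
  have key : ∀ (p : Polynomial ℝ) (z : ℝ), p.natDegree ≤ n →
      p.eval z = ∑ m : Fin (n + 1), z ^ (m : ℕ) * p.coeff m := by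
    intro p z hp
    rw [Polynomial.eval_eq_sum_range' (Nat.lt_succ_of_le hp), ← Fin.sum_univ_eq_sum_range
      (fun m => p.coeff m * z ^ m)]
    exact Finset.sum_congr rfl fun _ _ => mul_comm _ _
  ext i c
  rw [Matrix.mul_apply]
  refine Fin.cases ?_ (fun j => ?_) c
  · simp only [rootMatrix, rootCoeffMatrix, Matrix.of_apply, Fin.cons_zero,
      Matrix.vandermonde_apply]
    rw [← rootPolynomial_eval, key _ _ (rootPolynomial_natDegree y).le]
  · simp only [rootMatrix, rootCoeffMatrix, Matrix.of_apply, Fin.cons_succ,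
      Matrix.vandermonde_apply]
    rw [← key]
    · simp [Polynomial.eval_prod]
    · refine (Polynomial.natDegree_prod_le _ _).trans ?_
      simp

lemma det_rootMatrix_cons {n : ℕ} (y : Fin n → ℝ) (z : ℝ) :
    (rootMatrix (Fin.cons z y) y).det =
      (∏ j, (z - y j)) * ∏ j, ∏ l ∈ Finset.univ.erase j, (y j - y l) := by
  rw [Matrix.det_of_isUpperTriangular, Fin.prod_univ_succ]
  · simp [rootMatrix]
  · intro i j hij
    have hij' : j < i := hij
    obtain ⟨i, rfl⟩ := Fin.exists_succ_eq.mpr (Fin.ne_zero_of_lt hij')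
    refine Fin.cases ?_ (fun j hj => ?_) j hij'
    · intro _
      simp only [rootMatrix, Matrix.of_apply, Fin.cons_zero, Fin.cons_succ]
      exact Finset.prod_eq_zero (Finset.mem_univ i) (sub_self _)
    · simp only [rootMatrix, Matrix.of_apply, Fin.cons_succ]
      refine Finset.prod_eq_zero (Finset.mem_erase.mpr ⟨?_, Finset.mem_univ i⟩) (sub_self _)
      exact (Fin.succ_lt_succ_iff.mp hj).ne'

lemma det_vandermonde_cons {n : ℕ} (y : Fin n → ℝ) (z : ℝ) :
    (Matrix.vandermonde (Fin.cons z y : Fin (n + 1) → ℝ)).det =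
      (∏ j, (y j - z)) * (Matrix.vandermonde y).det := by
  simp only [Matrix.det_vandermonde, Fin.prod_univ_succ, Fin.cons_zero, Fin.cons_succ,
    Fin.Ioi_zero_eq_map, Fin.Ioi_succ, Finset.prod_map, Fin.coe_succEmb]

/-- The coefficient matrix does not depend on the nodes, so they may be taken to be `y` and one
further point `z`. Then `rootMatrix` is triangular, and `∏ j, (z - y j)` and one Vandermonde factor
cancel. -/
lemma abs_det_rootCoeffMatrix {n : ℕ} {y : Fin n → ℝ} (hy : Function.Injective y) :
    |(rootCoeffMatrix y).det| = |(Matrix.vandermonde y).det| := by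
  obtain ⟨z, hz⟩ := Infinite.exists_notMem_finset (Finset.univ.image y)
  have hz' : ∀ j, z - y j ≠ 0 := fun j h =>
    hz (Finset.mem_image.mpr ⟨j, Finset.mem_univ _, (sub_eq_zero.mp h).symm⟩)
  have h1 := det_rootMatrix_cons y z
  rw [rootMatrix_eq, Matrix.det_mul, det_vandermonde_cons] at h1
  have h2 := congrArg abs h1
  rw [abs_mul, abs_mul, abs_mul, abs_prod_prod_node_sub, ← sq_abs (Matrix.det _)] at h2
  have h3 : |∏ j, (y j - z)| = |∏ j, (z - y j)| := by
    simp only [Finset.abs_prod, abs_sub_comm]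
  have h4 : |∏ j, (z - y j)| ≠ 0 := abs_ne_zero.mpr (Finset.prod_ne_zero_iff.mpr fun j _ => hz' j)
  have h5 : |(Matrix.vandermonde y).det| ≠ 0 :=
    abs_ne_zero.mpr (Matrix.det_vandermonde_ne_zero_iff.mpr hy)
  rw [h3, mul_assoc] at h2
  have h6 := mul_left_cancel₀ h4 h2
  rw [sq] at h6
  exact mul_left_cancel₀ h5 h6

/-- The Jacobian matrix of `lagrangeWeights x`. -/
noncomputable def lagrangeJacobian {n : ℕ} (x v : Fin (n + 1) → ℝ) :
    Matrix (Fin (n + 1)) (Fin (n + 1)) ℝ :=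
  Matrix.diagonal (fun i => (∏ j, (x i - x (i.succAbove j)))⁻¹) *
    rootMatrix x (fun j => v j.succ) * Matrix.diagonal (Fin.cons 1 fun _ => -v 0)

lemma hasFDerivAt_lagrangeWeights {n : ℕ} (x v : Fin (n + 1) → ℝ) :
    HasFDerivAt (lagrangeWeights x)
      (LinearMap.toContinuousLinearMap (Matrix.toLin' (lagrangeJacobian x v))) v := by
  rw [hasFDerivAt_pi']
  intro i
  have h0 : HasFDerivAt (fun u : Fin (n + 1) → ℝ => u 0)
      (ContinuousLinearMap.proj (R := ℝ) 0 : (Fin (n + 1) → ℝ) →L[ℝ] ℝ) v :=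
    hasFDerivAt_apply 0 v
  have hj : ∀ j : Fin n, HasFDerivAt (fun u : Fin (n + 1) → ℝ => x i - u j.succ)
      (-(ContinuousLinearMap.proj (R := ℝ) j.succ : (Fin (n + 1) → ℝ) →L[ℝ] ℝ)) v := fun j =>
    (hasFDerivAt_apply j.succ v).const_sub (x i)
  have hp := HasFDerivAt.finsetProd (u := Finset.univ) fun j _ => hj j
  have hm := (h0.mul hp).const_mul (∏ j, (x i - x (i.succAbove j)))⁻¹
  have hfun : (fun u => lagrangeWeights x u i) =
      fun u => (∏ j, (x i - x (i.succAbove j)))⁻¹ * (u 0 * ∏ j : Fin n, (x i - u j.succ)) := by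
    funext u
    simp only [lagrangeWeights, Finset.prod_div_distrib]
    ring
  rw [hfun]
  have hm' : HasFDerivAt
      (fun u => (∏ j, (x i - x (i.succAbove j)))⁻¹ * (u 0 * ∏ j : Fin n, (x i - u j.succ)))
      _ v := hm
  refine hm'.congr_fderiv ?_
  ext u
  have hent : ∀ c, lagrangeJacobian x v i c = (∏ j, (x i - x (i.succAbove j)))⁻¹ *
      rootMatrix x (fun j => v j.succ) i c *
        (Fin.cons 1 (fun _ => -v 0) : Fin (n + 1) → ℝ) c := by
    intro c
    rw [lagrangeJacobian, Matrix.mul_diagonal, Matrix.diagonal_mul]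
  have hlhs : (ContinuousLinearMap.proj (R := ℝ) i ∘SL
      LinearMap.toContinuousLinearMap (Matrix.toLin' (lagrangeJacobian x v))) u =
      ∑ c, lagrangeJacobian x v i c * u c := rfl
  rw [hlhs, Fin.sum_univ_succ]
  simp only [hent, rootMatrix, Matrix.of_apply, Fin.cons_zero, Fin.cons_succ]
  simp only [smul_apply, add_apply, sum_apply, neg_apply, ContinuousLinearMap.proj_apply,
    smul_eq_mul, mul_add, Finset.mul_sum]
  rw [add_comm]
  congr 1
  · ring
  · exact Finset.sum_congr rfl fun j _ => by ring

lemma det_vandermonde_pos {n : ℕ} {x : Fin n → ℝ} (hx : StrictMono x) :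
    0 < (Matrix.vandermonde x).det := by
  rw [Matrix.det_vandermonde]
  refine Finset.prod_pos fun i _ => Finset.prod_pos fun j hj => ?_
  exact sub_pos.mpr (hx (Finset.mem_Ioi.mp hj))

/-- The row factors contribute `Δ(x) ^ (-2)`, the root matrix `Δ(x) Δ(y)`, and the column factors `v
0 ^ n`. -/
lemma abs_det_lagrangeJacobian {n : ℕ} {x v : Fin (n + 1) → ℝ} (hx : StrictMono x)
    (hv0 : 0 < v 0) (hv : StrictMono fun j : Fin n => v j.succ) :
    |(lagrangeJacobian x v).det| = v 0 ^ n * ((Matrix.vandermonde fun j : Fin n => v j.succ).det /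
      (Matrix.vandermonde x).det) := by
  have hx0 := det_vandermonde_pos hx
  have hv1 := det_vandermonde_pos hv
  rw [lagrangeJacobian, Matrix.det_mul, Matrix.det_mul, Matrix.det_diagonal, Matrix.det_diagonal,
    rootMatrix_eq, Matrix.det_mul, abs_mul, abs_mul, abs_mul,
    abs_det_rootCoeffMatrix hv.injective, Finset.prod_inv_distrib, abs_inv]
  have he : ∀ i, ∏ j, (x i - x (i.succAbove j)) = ∏ k ∈ Finset.univ.erase i, (x i - x k) :=
    fun i => (prod_erase_eq_prod_succAbove i fun k => x i - x k).symm
  simp only [he]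
  rw [abs_prod_prod_node_sub, abs_of_pos hx0, abs_of_pos hv1]
  simp only [Fin.prod_univ_succ, Fin.cons_zero, Fin.cons_succ, Finset.prod_const, Finset.card_univ, Fintype.card_fin,
    one_mul, abs_pow, abs_neg, abs_of_pos hv0]
  field_simp

lemma measurableSet_interlacing {n : ℕ} :
    MeasurableSet {q : (Fin (n + 1) → ℝ) × (Fin n → ℝ) | q.2 ∈ interlacingSet q.1} := by
  have : {q : (Fin (n + 1) → ℝ) × (Fin n → ℝ) | q.2 ∈ interlacingSet q.1} =
      ⋂ i : Fin n, {q | q.1 i.castSucc < q.2 i} ∩ {q | q.2 i < q.1 i.succ} := by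
    ext q
    simp [interlacingSet]
  rw [this]
  refine MeasurableSet.iInter fun i => MeasurableSet.inter ?_ ?_ <;>
  exact measurableSet_lt (by fun_prop) (by fun_prop)

lemma measurableSet_interlacingSet {n : ℕ} (x : Fin (n + 1) → ℝ) :
    MeasurableSet (interlacingSet x) :=
  measurable_prodMk_left measurableSet_interlacing

/-- The roots of the interpolated polynomial with random weights have density proportional to the
ratio of the Vandermonde determinants on the interlacing set. -/
lemma simplexAverage_eq {n : ℕ} {H : (ℕ → ℝ) → ℝ≥0∞} (hH : Measurable H)
    {x : Fin (n + 1) → ℝ} (hx : StrictMono x) :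
    simplexAverage H x = (∫⁻ s in Set.Ioc (0 : ℝ) 1, ENNReal.ofReal (s ^ n)) *
      ∫⁻ y in interlacingSet x, ENNReal.ofReal ((Matrix.vandermonde y).det /
        (Matrix.vandermonde x).det) * H (charValues y) := by
  set S : Set (Fin (n + 1) → ℝ) :=
    {v | 0 < v 0 ∧ (fun j : Fin n => v j.succ) ∈ interlacingSet x} with hS
  have hSm : MeasurableSet S := by
    refine (measurableSet_lt measurable_const (measurable_pi_apply 0)).inter ?_
    have : Measurable fun (v : Fin (n + 1) → ℝ) (j : Fin n) => v j.succ := by fun_prop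
    exact this (measurableSet_interlacingSet x)
  set G : (Fin (n + 1) → ℝ) → ℝ≥0∞ :=
    {w : Fin (n + 1) → ℝ | ∑ i, w i ≤ 1}.indicator fun w => H (secularValues x w) with hG
  have h1 : simplexAverage H x = ∫⁻ w in lagrangeWeights x '' S, G w := by
    rw [image_lagrangeWeights hx, hG, lintegral_indicator measurableSet_sum_le_one,
        Measure.restrict_restrict measurableSet_sum_le_one, simplexAverage]
    congr 2
    ext w
    simp [and_comm]
  rw [h1, lintegral_image_eq_lintegral_abs_det_fderiv_mul volume hSm
    (fun v _ => (hasFDerivAt_lagrangeWeights x v).hasFDerivWithinAt) (injOn_lagrangeWeights hx)]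
  -- The sum of the weights is `v 0`, so the truncation reads `v 0 ≤ 1` and the integrand splits
  -- into a function of the leading coefficient and one of the roots.
  set A : ℝ → ℝ≥0∞ := (Set.Ioc (0 : ℝ) 1).indicator fun s => ENNReal.ofReal (s ^ n) with hA
  set B : (Fin n → ℝ) → ℝ≥0∞ := (interlacingSet x).indicator fun y =>
    ENNReal.ofReal ((Matrix.vandermonde y).det / (Matrix.vandermonde x).det) * H (charValues y)
    with hB
  have hdet : Measurable fun y : Fin n → ℝ => (Matrix.vandermonde y).det := by
    simp only [Matrix.det_vandermonde]
    fun_prop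
  have hAm : Measurable A :=
    (ENNReal.measurable_ofReal.comp (by fun_prop)).indicator measurableSet_Ioc
  have hBm : Measurable B := by
    refine Measurable.indicator ?_ (measurableSet_interlacingSet x)
    exact (ENNReal.measurable_ofReal.comp (hdet.div_const _)).mul
      (hH.comp continuous_charValues.measurable)
  have h2 : ∀ v ∈ S, ENNReal.ofReal |(LinearMap.toContinuousLinearMap
      (Matrix.toLin' (lagrangeJacobian x v))).det| * G (lagrangeWeights x v) =
      A (v 0) * B fun j => v j.succ := by
    rintro v ⟨hv0, hv⟩
    have hv0' : (0 : ℝ) < v 0 := hv0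
    have hsm := strictMono_of_mem_interlacingSet hv
    have hd : (LinearMap.toContinuousLinearMap
      (Matrix.toLin' (lagrangeJacobian x v))).det = (lagrangeJacobian x v).det := by
      rw [ContinuousLinearMap.det, LinearMap.coe_toContinuousLinearMap, LinearMap.det_toLin']
    rw [hd, abs_det_lagrangeJacobian hx hv0 hsm, ENNReal.ofReal_mul (by positivity), hB,
      Set.indicator_of_mem hv]
    by_cases h : v 0 ≤ 1
    · rw [hA, Set.indicator_of_mem (show v 0 ∈ Set.Ioc 0 1 from ⟨hv0, h⟩), hG,
        Set.indicator_of_mem, secularValues_lagrangeWeights hx.injective hv0'.ne', mul_assoc]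
      simpa [sum_lagrangeWeights hx.injective] using h
    · rw [hA, Set.indicator_of_notMem (fun h' => h h'.2), hG, Set.indicator_of_notMem]
      · simp
      · simpa [sum_lagrangeWeights hx.injective] using h
  rw [setLIntegral_congr_fun hSm h2]
  have h3 : ∫⁻ v in S, (A (v 0) * B fun j => v j.succ) =
      ∫⁻ v : Fin (n + 1) → ℝ, A (v 0) * B fun j => v j.succ := by
    rw [← lintegral_indicator hSm]
    refine lintegral_congr fun v => ?_
    by_cases hv : v ∈ S
    · rw [Set.indicator_of_mem hv]
    · rw [Set.indicator_of_notMem hv]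
      by_cases h0 : 0 < v 0
      · have : (fun j : Fin n => v j.succ) ∉ interlacingSet x := fun h => hv ⟨h0, h⟩
        rw [hB, Set.indicator_of_notMem this, mul_zero]
      · rw [hA, Set.indicator_of_notMem (fun h' => h0 h'.1), zero_mul]
  have h4 := (volume_preserving_piFinSuccAbove (fun _ : Fin (n + 1) => ℝ) 0).lintegral_comp_emb
    (MeasurableEquiv.measurableEmbedding _) fun q : ℝ × (Fin n → ℝ) => A q.1 * B q.2
  rw [h3]
  refine h4.trans ?_
  rw [Measure.volume_eq_prod, lintegral_prod_mul hAm.aemeasurable hBm.aemeasurable, hA, hB,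
    lintegral_indicator measurableSet_Ioc, lintegral_indicator (measurableSet_interlacingSet x)]

lemma lintegral_Ioc_pow_ne_zero (n : ℕ) :
    ∫⁻ s in Set.Ioc (0 : ℝ) 1, ENNReal.ofReal (s ^ n) ≠ 0 := by
  intro h
  rw [setLIntegral_eq_zero_iff measurableSet_Ioc (by fun_prop)] at h
  have h1 : volume (Set.Ioc (0 : ℝ) 1) = 0 := by
    refine measure_mono_null ?_ (ae_iff.mp h)
    intro s hs
    simp only [Set.mem_ofPred_eq, Classical.not_imp]
    refine ⟨hs, ?_⟩
    have := pow_pos hs.1 n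
    simpa using this
  simp at h1

lemma lintegral_Ioc_pow_ne_top (n : ℕ) :
    ∫⁻ s in Set.Ioc (0 : ℝ) 1, ENNReal.ofReal (s ^ n) ≠ ⊤ := by
  refine ((setLIntegral_mono' (g := fun _ => 1) measurableSet_Ioc ?_).trans_lt ?_).ne
  · intro s hs
    rw [ENNReal.ofReal_le_one]
    exact pow_le_one₀ hs.1.le hs.2
  · simp

/-! ### Symmetry and measurability of the density -/

lemma polynomialEnsembleDensity_comp_perm {n : ℕ} (f : Fin n → ℝ → ℝ) (Z : ℝ) (x : Fin n → ℝ)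
    (σ : Equiv.Perm (Fin n)) :
    polynomialEnsembleDensity f Z (x ∘ σ) = polynomialEnsembleDensity f Z x := by
  have h1 : (Matrix.vandermonde (x ∘ σ)).det =
      ((Equiv.Perm.sign σ : ℤ) : ℝ) * (Matrix.vandermonde x).det := by
    rw [← Matrix.det_permute]
    rfl
  have h2 : (Matrix.of fun j k => f k ((x ∘ σ) j)).det =
      ((Equiv.Perm.sign σ : ℤ) : ℝ) * (Matrix.of fun j k => f k (x j)).det := by
    rw [← Matrix.det_permute]
    rfl
  have h3 : (∀ j, 0 < (x ∘ σ) j) ↔ ∀ j, 0 < x j :=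
    ⟨fun h i => by simpa using h (σ.symm i), fun h i => h _⟩
  have h4 : ((Equiv.Perm.sign σ : ℤ) : ℝ) * ((Equiv.Perm.sign σ : ℤ) : ℝ) = 1 := by
    rw [← Int.cast_mul, ← Units.val_mul, Int.units_mul_self]
    simp
  unfold polynomialEnsembleDensity
  simp only [h1, h2, h3]
  split_ifs
  · calc _ = (((Equiv.Perm.sign σ : ℤ) : ℝ) * ((Equiv.Perm.sign σ : ℤ) : ℝ)) *
        (Z⁻¹ * (Matrix.vandermonde x).det * (Matrix.of fun j k => f k (x j)).det) := by ring
      _ = _ := by rw [h4, one_mul]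
  · rfl

lemma measurable_det_vandermonde {n : ℕ} :
    Measurable fun y : Fin n → ℝ => (Matrix.vandermonde y).det := by
  simp only [Matrix.det_vandermonde]
  fun_prop

lemma restrict_univ_pi {m : ℕ} (s : Fin m → Set ℝ) :
    (volume : Measure (Fin m → ℝ)).restrict (Set.univ.pi s) =
      Measure.pi fun j => volume.restrict (s j) := by
  rw [volume_pi, Measure.restrict_pi_pi]

lemma aemeasurable_polynomialEnsembleDensity {n : ℕ} {f : Fin n → ℝ → ℝ} (Z : ℝ)
    (hf : ∀ k, AEMeasurable (f k) (volume.restrict (Set.Ioi 0))) :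
    AEMeasurable (polynomialEnsembleDensity f Z) := by
  classical
  have h0 : {x : Fin n → ℝ | ∀ j, 0 < x j} = Set.univ.pi fun _ => Set.Ioi 0 := by ext; simp
  have h1 : polynomialEnsembleDensity f Z = {x : Fin n → ℝ | ∀ j, 0 < x j}.indicator
      fun x => Z⁻¹ * (Matrix.vandermonde x).det * (Matrix.of fun j k => f k (x j)).det := by
    funext x
    simp [polynomialEnsembleDensity, Set.indicator_apply]
  rw [h1, aemeasurable_indicator_iff measurableSet_pos]
  refine (measurable_det_vandermonde.const_mul _).aemeasurable.mul ?_
  simp only [Matrix.det_apply, Matrix.of_apply]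
  refine Finset.aemeasurable_fun_sum _ fun σ _ => AEMeasurable.const_smul ?_ _
  refine Finset.aemeasurable_fun_prod _ fun k _ => ?_
  rw [h0, restrict_univ_pi]
  exact (hf k).comp_quasiMeasurePreserving (Measure.quasiMeasurePreserving_eval _ (σ k))

/-! ### Integrating over the interlacing vectors -/

lemma strictMono_of_interlacing {n : ℕ} {x : Fin (n + 1) → ℝ} {y : Fin n → ℝ}
    (h : y ∈ interlacingSet x) : StrictMono x :=
  Fin.strictMono_iff_lt_succ.mpr fun i => (h i).1.trans (h i).2

/-- The positive numbers below `y i` if `j = i < n`, all positive numbers if `j = n`. -/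
def initialCell {n : ℕ} (y : Fin n → ℝ) (j : Fin (n + 1)) : Set ℝ :=
  {t | 0 < t ∧ ∀ i : Fin n, i.castSucc = j → t < y i}

/-- The positive numbers that may be the `j`-th component of a vector interlaced by `y`. -/
def interlacingCell {n : ℕ} (y : Fin n → ℝ) (j : Fin (n + 1)) : Set ℝ :=
  {t | 0 < t ∧ (∀ i : Fin n, i.castSucc = j → t < y i) ∧ ∀ i : Fin n, i.succ = j → y i < t}

lemma initialCell_castSucc {n : ℕ} (y : Fin n → ℝ) (i : Fin n) :
    initialCell y i.castSucc = Set.Ioo 0 (y i) := by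
  ext t
  simp [initialCell]

lemma initialCell_last {n : ℕ} (y : Fin n → ℝ) : initialCell y (Fin.last n) = Set.Ioi 0 := by
  ext t
  simp [initialCell, Fin.castSucc_ne_last]

lemma measurableSet_initialCell {n : ℕ} (y : Fin n → ℝ) (j : Fin (n + 1)) :
    MeasurableSet (initialCell y j) := by
  refine Fin.lastCases ?_ (fun i => ?_) j
  · rw [initialCell_last]; exact measurableSet_Ioi
  · rw [initialCell_castSucc]; exact measurableSet_Ioo

lemma interlacingCell_zero {n : ℕ} (y : Fin n → ℝ) : interlacingCell y 0 = initialCell y 0 := by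
  ext t
  simp [initialCell, interlacingCell, Fin.succ_ne_zero]

lemma interlacingCell_succ {n : ℕ} (y : Fin n → ℝ) (i : Fin n) :
    interlacingCell y i.succ = initialCell y i.succ ∩ Set.Ioi (y i) := by
  ext t
  simp [initialCell, interlacingCell, and_assoc]

lemma measurableSet_interlacingCell {n : ℕ} (y : Fin n → ℝ) (j : Fin (n + 1)) :
    MeasurableSet (interlacingCell y j) := by
  refine Fin.cases ?_ (fun i => ?_) j
  · rw [interlacingCell_zero]; exact measurableSet_initialCell y 0
  · rw [interlacingCell_succ]; exact (measurableSet_initialCell y _).inter measurableSet_Ioi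

lemma interlacingCell_subset {n : ℕ} (y : Fin n → ℝ) (j : Fin (n + 1)) :
    interlacingCell y j ⊆ Set.Ioi 0 := fun _ ht => ht.1

lemma initialCell_subset {n : ℕ} (y : Fin n → ℝ) (j : Fin (n + 1)) :
    initialCell y j ⊆ Set.Ioi 0 := fun _ ht => ht.1

/-- For fixed `y`, interlacing constrains each `x j` separately; this makes the integral over `x` a
determinant. -/
lemma mem_pi_interlacingCell {n : ℕ} (x : Fin (n + 1) → ℝ) (y : Fin n → ℝ) :
    x ∈ Set.univ.pi (interlacingCell y) ↔ (∀ j, 0 < x j) ∧ y ∈ interlacingSet x := by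
  simp only [Set.mem_pi, Set.mem_univ, forall_true_left, interlacingCell, Set.mem_ofPred_eq,
    interlacingSet]
  constructor
  · exact fun h => ⟨fun j => (h j).1, fun i => ⟨(h _).2.1 i rfl, (h _).2.2 i rfl⟩⟩
  · rintro ⟨h0, h⟩ j
    exact ⟨h0 j, fun i hi => hi ▸ (h i).1, fun i hi => hi ▸ (h i).2⟩

/-- The matrix of the integrals of the `f k` over initial intervals. -/
noncomputable def initialIntegrals {n : ℕ} (f : Fin (n + 1) → ℝ → ℝ) (y : Fin n → ℝ) :
    Matrix (Fin (n + 1)) (Fin (n + 1)) ℝ :=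
  Matrix.of fun j k => ∫ t in initialCell y j, f k t

/-- A cell is the initial cell with the same index minus the preceding initial interval, so adding
the preceding row of initial integrals restores the initial integral. -/
lemma det_integral_interlacingCell {n : ℕ} {f : Fin (n + 1) → ℝ → ℝ}
    (hf : ∀ k, IntegrableOn (f k) (Set.Ioi 0)) {y : Fin n → ℝ} (hy : StrictMono y) :
    (Matrix.of fun j k => ∫ t in interlacingCell y j, f k t).det = (initialIntegrals f y).det := by
  symm
  refine Matrix.det_eq_of_forall_row_eq_smul_add_pred (fun _ => 1) ?_ ?_
  · intro k
    simp [initialIntegrals, interlacingCell_zero]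
  · intro i k
    simp only [initialIntegrals, Matrix.of_apply, one_mul]
    have hmono : Set.Ioc 0 (y i) ⊆ initialCell y i.succ := by
      rintro t ⟨ht0, ht⟩
      refine ⟨ht0, fun l hl => ht.trans_lt (hy ?_)⟩
      rw [Fin.lt_def]
      have := congrArg Fin.val hl
      simp at this
      omega
    have hdiff : interlacingCell y i.succ = initialCell y i.succ \ Set.Ioc 0 (y i) := by
      rw [interlacingCell_succ]
      ext t
      simp only [Set.mem_inter_iff, Set.mem_Ioi, Set.mem_sdiff, Set.mem_Ioc, not_and, not_le]
      exact and_congr_right fun h => ⟨fun h' _ => h', fun h' => h' h.1⟩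
    rw [hdiff, setIntegral_sdiff measurableSet_Ioc ((hf k).mono_set (initialCell_subset y _)) hmono,
      initialCell_castSucc, ← integral_Ioc_eq_integral_Ioo]
    ring

/-- In the Leibniz expansion every term is a product of functions of one variable each, so Fubini
applies termwise. -/
lemma integral_det_eq_det_integral {m : ℕ} (f : Fin m → ℝ → ℝ) (s : Fin m → Set ℝ)
    (hf : ∀ j k, IntegrableOn (f k) (s j)) :
    IntegrableOn (fun x : Fin m → ℝ => (Matrix.of fun j k => f k (x j)).det) (Set.univ.pi s) ∧
    ∫ x in Set.univ.pi s, (Matrix.of fun j k => f k (x j)).det =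
      (Matrix.of fun j k => ∫ t in s j, f k t).det := by
  have hd : ∀ M : Matrix (Fin m) (Fin m) ℝ,
      M.det = ∑ σ : Equiv.Perm (Fin m), (Equiv.Perm.sign σ : ℝ) * ∏ i, M i (σ i) := by
    intro M
    rw [← Matrix.det_transpose, Matrix.det_apply']
    rfl
  have hint : ∀ σ : Equiv.Perm (Fin m), Integrable (fun x : Fin m → ℝ =>
      (Equiv.Perm.sign σ : ℝ) * ∏ i, f (σ i) (x i))
      (Measure.pi fun j => volume.restrict (s j)) := fun σ =>
    (Integrable.fintype_prod (fun i => hf i (σ i))).const_mul _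
  simp only [hd, Matrix.of_apply]
  rw [IntegrableOn, restrict_univ_pi]
  refine ⟨integrable_finsetSum _ fun σ _ => hint σ, ?_⟩
  rw [integral_finsetSum _ fun σ _ => hint σ]
  refine Finset.sum_congr rfl fun σ _ => ?_
  rw [integral_const_mul]
  congr 1
  exact integral_fintype_prod_eq_prod (fun i => f (σ i))

lemma polynomialEnsembleDensity_of_pos {n : ℕ} {f : Fin n → ℝ → ℝ} {Z : ℝ} {x : Fin n → ℝ}
    (hx : ∀ j, 0 < x j) : polynomialEnsembleDensity f Z x =
      Z⁻¹ * (Matrix.vandermonde x).det * (Matrix.of fun j k => f k (x j)).det := by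
  rw [polynomialEnsembleDensity, if_pos hx]

lemma inv_mul_det_nonneg {n : ℕ} {f : Fin n → ℝ → ℝ} {Z : ℝ}
    (hf : ∀ x, 0 ≤ polynomialEnsembleDensity f Z x) {x : Fin n → ℝ} (hx : ∀ j, 0 < x j)
    (hm : StrictMono x) : 0 ≤ Z⁻¹ * (Matrix.of fun j k => f k (x j)).det := by
  have h := hf x
  rw [polynomialEnsembleDensity_of_pos hx, mul_right_comm] at h
  exact nonneg_of_mul_nonneg_left h (det_vandermonde_pos hm)

lemma integral_interlacing {n : ℕ} {f : Fin (n + 1) → ℝ → ℝ} {Z : ℝ}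
    (hf : ∀ k, IntegrableOn (f k) (Set.Ioi 0))
    (hp : ∀ x, 0 ≤ polynomialEnsembleDensity f Z x) {y : Fin n → ℝ} (hy : StrictMono y) :
    0 ≤ Z⁻¹ * (initialIntegrals f y).det ∧
    ∫⁻ x in Set.univ.pi (interlacingCell y),
      ENNReal.ofReal (Z⁻¹ * (Matrix.of fun j k => f k (x j)).det) =
    ENNReal.ofReal (Z⁻¹ * (initialIntegrals f y).det) := by
  obtain ⟨h1, h2⟩ := integral_det_eq_det_integral f (interlacingCell y)
    fun j k => (hf k).mono_set (interlacingCell_subset y j)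
  have hms : MeasurableSet (Set.univ.pi (interlacingCell y)) :=
    MeasurableSet.univ_pi fun j => measurableSet_interlacingCell y j
  have hnn : ∀ x ∈ Set.univ.pi (interlacingCell y),
      0 ≤ Z⁻¹ * (Matrix.of fun j k => f k (x j)).det := by
    intro x hx
    obtain ⟨hx0, hxy⟩ := (mem_pi_interlacingCell x y).mp hx
    exact inv_mul_det_nonneg hp hx0 (strictMono_of_interlacing hxy)
  have h3 : ∫ x in Set.univ.pi (interlacingCell y), Z⁻¹ * (Matrix.of fun j k => f k (x j)).det =
      Z⁻¹ * (initialIntegrals f y).det := by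
    rw [integral_const_mul, h2, det_integral_interlacingCell hf hy]
  rw [← h3]
  refine ⟨setIntegral_nonneg hms hnn, ?_⟩
  rw [ofReal_integral_eq_lintegral_ofReal (h1.const_mul _) (ae_restrict_of_forall_mem hms hnn)]

/-- The factor `1 / Δ(x)` of the conditional density of `y` cancels `Δ(x)` in the density of `x`.
After exchanging the integrals, the inner one runs over the box of cells of `y`. -/
lemma lintegral_density_mul_simplexAverage {n : ℕ} {f : Fin (n + 1) → ℝ → ℝ} {Z : ℝ}
    (hf : ∀ k, IntegrableOn (f k) (Set.Ioi 0))
    (hp : ∀ x, 0 ≤ polynomialEnsembleDensity f Z x)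
    {H : (ℕ → ℝ) → ℝ≥0∞} (hH : Measurable H) :
    ∫⁻ x, ENNReal.ofReal (polynomialEnsembleDensity f Z x) * simplexAverage H x =
      ((n + 1) ! : ℕ) * (∫⁻ s in Set.Ioc (0 : ℝ) 1, ENNReal.ofReal (s ^ n)) *
      ∫⁻ y in {y : Fin n → ℝ | StrictMono y}, {y : Fin n → ℝ | ∀ j, 0 < y j}.indicator
        (fun y => ENNReal.ofReal (Z⁻¹ * (Matrix.vandermonde y).det * (initialIntegrals f y).det)) y *
        H (charValues y) := by
  set c := ∫⁻ s in Set.Ioc (0 : ℝ) 1, ENNReal.ofReal (s ^ n) with hc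
  have hct : c ≠ ⊤ := lintegral_Ioc_pow_ne_top n
  set D : (Fin (n + 1) → ℝ) → ℝ≥0∞ := fun x => ENNReal.ofReal (polynomialEnsembleDensity f Z x)
    with hD
  have hDm : AEMeasurable D := ENNReal.measurable_ofReal.comp_aemeasurable
    (aemeasurable_polynomialEnsembleDensity Z fun k => (hf k).aestronglyMeasurable.aemeasurable)
  set K : (Fin (n + 1) → ℝ) × (Fin n → ℝ) → ℝ≥0∞ :=
    {q : (Fin (n + 1) → ℝ) × (Fin n → ℝ) | q.2 ∈ interlacingSet q.1}.indicator fun q =>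
      ENNReal.ofReal ((Matrix.vandermonde q.2).det / (Matrix.vandermonde q.1).det) *
        H (charValues q.2) with hK
  have hKm : Measurable K := by
    refine Measurable.indicator ?_ measurableSet_interlacing
    exact (ENNReal.measurable_ofReal.comp ((measurable_det_vandermonde.comp measurable_snd).div
      (measurable_det_vandermonde.comp measurable_fst))).mul
      (hH.comp (continuous_charValues.measurable.comp measurable_snd))
  have hKint : ∀ x, ∫⁻ y in interlacingSet x, ENNReal.ofReal ((Matrix.vandermonde y).det /
        (Matrix.vandermonde x).det) * H (charValues y) = ∫⁻ y, K (x, y) := by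
    intro x
    rw [← lintegral_indicator (measurableSet_interlacingSet x)]
    rfl
  have hKin : ∀ x y, y ∈ interlacingSet x → K (x, y) = ENNReal.ofReal
      ((Matrix.vandermonde y).det / (Matrix.vandermonde x).det) * H (charValues y) := by
    intro x y h
    rw [hK, Set.indicator_of_mem (by exact h)]
  have hKout : ∀ x y, y ∉ interlacingSet x → K (x, y) = 0 := by
    intro x y h
    rw [hK, Set.indicator_of_notMem (by exact h)]
  have hK0 : ∀ x, ¬ StrictMono x → ∀ y, K (x, y) = 0 := fun x hx y =>
    hKout x y fun h => hx (strictMono_of_interlacing h)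
  have h1 : ∫⁻ x in {x | StrictMono x}, D x * simplexAverage H x =
      c * ∫⁻ x, ∫⁻ y, D x * K (x, y) := by
    rw [← lintegral_indicator measurableSet_strictMono, ← lintegral_const_mul' _ _ hct]
    refine lintegral_congr fun x => ?_
    have hKx : Measurable fun y => K (x, y) := hKm.comp measurable_prodMk_left
    rw [lintegral_const_mul _ hKx]
    by_cases hx : StrictMono x
    · rw [Set.indicator_of_mem (show x ∈ {x | StrictMono x} from hx), simplexAverage_eq hH hx,
        hKint]
      ring
    · rw [Set.indicator_of_notMem (show x ∉ {x | StrictMono x} from hx)]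
      simp [hK0 x hx]
  have h2 : ∫⁻ x, ∫⁻ y, D x * K (x, y) = ∫⁻ y, ∫⁻ x, D x * K (x, y) := by
    refine lintegral_lintegral_swap ?_
    exact hDm.comp_fst.mul hKm.aemeasurable
  have h3 : ∀ y, ∫⁻ x, D x * K (x, y) = {y : Fin n → ℝ | StrictMono y}.indicator (fun y =>
      {y : Fin n → ℝ | ∀ j, 0 < y j}.indicator (fun y => ENNReal.ofReal
        (Z⁻¹ * (Matrix.vandermonde y).det * (initialIntegrals f y).det)) y * H (charValues y)) y := by
    intro y
    by_cases hy : StrictMono y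
    swap
    · rw [Set.indicator_of_notMem (show y ∉ {y | StrictMono y} from hy)]
      refine (lintegral_congr fun x => ?_).trans lintegral_zero
      rw [hKout x y fun h => hy (strictMono_of_mem_interlacingSet h), mul_zero]
    rw [Set.indicator_of_mem (show y ∈ {y | StrictMono y} from hy)]
    have hz : ∀ x, x ∉ Set.univ.pi (interlacingCell y) → D x * K (x, y) = 0 := by
      intro x hx
      rw [mem_pi_interlacingCell, not_and_or] at hx
      rcases hx with hx | hx
      · simp [hD, polynomialEnsembleDensity, hx]
      · rw [hKout x y hx, mul_zero]
    by_cases hy0 : ∀ j, 0 < y j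
    swap
    · rw [Set.indicator_of_notMem (show y ∉ {y : Fin n → ℝ | ∀ j, 0 < y j} from hy0), zero_mul]
      refine (lintegral_congr fun x => hz x fun hx => ?_).trans lintegral_zero
      obtain ⟨hx0, hxy⟩ := (mem_pi_interlacingCell x y).mp hx
      exact hy0 fun j => (hx0 _).trans (hxy j).1
    rw [Set.indicator_of_mem (show y ∈ {y : Fin n → ℝ | ∀ j, 0 < y j} from hy0)]
    have hms : MeasurableSet (Set.univ.pi (interlacingCell y)) :=
      MeasurableSet.univ_pi fun j => measurableSet_interlacingCell y j
    have h4 : ∫⁻ x, D x * K (x, y) = ∫⁻ x in Set.univ.pi (interlacingCell y), D x * K (x, y) := by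
      rw [← lintegral_indicator hms]
      refine lintegral_congr fun x => ?_
      by_cases hx : x ∈ Set.univ.pi (interlacingCell y)
      · rw [Set.indicator_of_mem hx]
      · rw [Set.indicator_of_notMem hx, hz x hx]
    have h5 : ∀ x ∈ Set.univ.pi (interlacingCell y), D x * K (x, y) =
        ENNReal.ofReal (Z⁻¹ * (Matrix.of fun j k => f k (x j)).det) *
          (ENNReal.ofReal (Matrix.vandermonde y).det * H (charValues y)) := by
      intro x hx
      obtain ⟨hx0, hxy⟩ := (mem_pi_interlacingCell x y).mp hx
      have hxm := strictMono_of_interlacing hxy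
      have hvx := det_vandermonde_pos hxm
      have hnn := inv_mul_det_nonneg hp hx0 hxm
      rw [hKin x y hxy, ← mul_assoc, ← mul_assoc, hD, ← ENNReal.ofReal_mul (hp x), ← ENNReal.ofReal_mul hnn,
        polynomialEnsembleDensity_of_pos hx0]
      congr 2
      field_simp
    obtain ⟨h6, h7⟩ := integral_interlacing hf hp hy
    rw [h4, setLIntegral_congr_fun hms h5, lintegral_mul_const'', h7, ← mul_assoc,
      ← ENNReal.ofReal_mul h6]
    · congr 2
      ring
    · refine ENNReal.measurable_ofReal.comp_aemeasurable ?_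
      have := (integral_det_eq_det_integral f (interlacingCell y)
        fun j k => (hf k).mono_set (interlacingCell_subset y j)).1
      exact this.aestronglyMeasurable.aemeasurable.const_mul _
  rw [lintegral_eq_factorial_mul_setLIntegral_strictMono, h1, h2,
    ← lintegral_indicator measurableSet_strictMono, mul_assoc]
  · simp only [h3]
  · intro x σ
    rw [polynomialEnsembleDensity_comp_perm, simplexAverage_comp_perm]

/-! ### Zero-integral combinations and reduction of the determinant -/

lemma integral_sum_smul {m : ℕ} {f : Fin m → ℝ → ℝ} {s : Set ℝ}
    (hf : ∀ k, IntegrableOn (f k) s) (c : Fin m → ℝ) :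
    ∫ t in s, (∑ k, c k • f k) t = ∑ k, c k * ∫ t in s, f k t := by
  simp only [Finset.sum_apply, Pi.smul_apply, smul_eq_mul]
  rw [integral_finsetSum _ fun k _ => (hf k).const_mul (c k)]
  simp only [integral_const_mul]

lemma integrableOn_sum_smul {m : ℕ} {f : Fin m → ℝ → ℝ} {s : Set ℝ}
    (hf : ∀ k, IntegrableOn (f k) s) (c : Fin m → ℝ) : IntegrableOn (∑ k, c k • f k) s := by
  have : (∑ k, c k • f k) = fun t => ∑ k, c k * f k t := by
    funext t
    simp
  rw [this]
  exact integrable_finsetSum _ fun k _ => (hf k).const_mul (c k)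

/-- A vanishing combination has zero integral over every initial cell, so its coefficients lie in
the kernel of the matrix. -/
lemma linearIndependent_of_det_initialIntegrals_ne_zero {n : ℕ} {f : Fin (n + 1) → ℝ → ℝ}
    (hf : ∀ k, IntegrableOn (f k) (Set.Ioi 0)) {y : Fin n → ℝ}
    (h : (initialIntegrals f y).det ≠ 0) : LinearIndependent ℝ f := by
  rw [Fintype.linearIndependent_iff]
  intro c hc
  refine congrFun (Matrix.eq_zero_of_mulVec_eq_zero h ?_)
  funext j
  have h1 := integral_sum_smul (fun k => (hf k).mono_set (initialCell_subset y j)) c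
  rw [hc] at h1
  simp only [Pi.zero_apply, integral_zero] at h1
  simp only [Matrix.mulVec, dotProduct, initialIntegrals, Matrix.of_apply, Pi.zero_apply]
  rw [h1]
  exact Finset.sum_congr rfl fun k _ => mul_comm _ _

lemma exists_integral_ne_zero_of_det_initialIntegrals_ne_zero {n : ℕ} {f : Fin (n + 1) → ℝ → ℝ}
    {y : Fin n → ℝ} (h : (initialIntegrals f y).det ≠ 0) :
    ∃ k, ∫ t in Set.Ioi 0, f k t ≠ 0 := by
  by_contra! h0
  apply h
  refine Matrix.det_eq_zero_of_row_eq_zero (Fin.last n) fun k => ?_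
  rw [initialIntegrals, Matrix.of_apply, initialCell_last, h0]

/-- In coefficients, the space is the kernel of a nonzero functional on an `(n + 1)`-dimensional
space. -/
lemma nonempty_basis_zeroIntegralCombinations {n : ℕ} {f : Fin (n + 1) → ℝ → ℝ}
    (hf : ∀ k, IntegrableOn (f k) (Set.Ioi 0)) (hli : LinearIndependent ℝ f)
    (hne : ∃ k, ∫ t in Set.Ioi 0, f k t ≠ 0) :
    Nonempty (Module.Basis (Fin n) ℝ (zeroIntegralCombinations f)) := by
  set T := Fintype.linearCombination ℝ f with hT
  set L := Fintype.linearCombination ℝ (fun k => ∫ t in Set.Ioi 0, f k t) with hL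
  have hTi : Function.Injective T := LinearMap.ker_eq_bot.mp
    (LinearMap.ker_eq_bot'.mpr fun c hc => funext (Fintype.linearIndependent_iff.mp hli c hc))
  have hV : zeroIntegralCombinations f = (LinearMap.ker L).map T := by
    ext g
    rw [Submodule.mem_map]
    constructor
    · rintro ⟨⟨c, rfl⟩, -, h0⟩
      rw [integral_sum_smul hf] at h0
      exact ⟨c, by simpa [hL, Fintype.linearCombination_apply] using h0, rfl⟩
    · rintro ⟨c, hc, rfl⟩
      refine ⟨⟨c, rfl⟩, integrableOn_sum_smul hf c, ?_⟩
      rw [hT, Fintype.linearCombination_apply, integral_sum_smul hf]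
      simpa [hL, Fintype.linearCombination_apply] using hc
  have hr : LinearMap.range L = ⊤ := by
    obtain ⟨k, hk⟩ := hne
    rw [LinearMap.range_eq_top]
    refine LinearMap.surjective fun h0 => hk ?_
    have := LinearMap.congr_fun h0 (Pi.single k 1)
    rw [hL, Fintype.linearCombination_apply_single] at this
    simpa using this
  have hk : Module.finrank ℝ (LinearMap.ker L) = n := by
    have := LinearMap.finrank_range_add_finrank_ker L
    rw [hr, finrank_top, Module.finrank_self, Module.finrank_fin_fun] at this
    omega
  have e := Submodule.equivMapOfInjective T hTi (LinearMap.ker L)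
  rw [hV]
  exact ⟨(Module.finBasisOfFinrankEq ℝ (LinearMap.ker L) hk).map e⟩

/-- Replacing the functions by a basis adapted to the kernel of the integral reduces the
determinant by one dimension. -/
lemma exists_det_initialIntegrals_eq {n : ℕ} {f : Fin (n + 1) → ℝ → ℝ}
    (hf : ∀ k, IntegrableOn (f k) (Set.Ioi 0))
    (hne : ∃ k, ∫ t in Set.Ioi 0, f k t ≠ 0)
    (ft : Module.Basis (Fin n) ℝ (zeroIntegralCombinations f)) :
    ∃ d : ℝ, d ≠ 0 ∧ ∀ y : Fin n → ℝ, (∀ j, 0 < y j) →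
      (Matrix.of fun j k => ∫ t in (0 : ℝ)..y j, (ft k : ℝ → ℝ) t).det =
        d * (initialIntegrals f y).det := by
  obtain ⟨k₀, hk₀⟩ := hne
  have hc : ∀ k, ∃ c : Fin (n + 1) → ℝ, (ft k : ℝ → ℝ) = ∑ j, c j • f j := fun k => (ft k).2.1
  choose c hc using hc
  have hft0 : ∀ k, ∫ t in Set.Ioi 0, (ft k : ℝ → ℝ) t = 0 := fun k => (ft k).2.2.2
  -- The rows are the coefficients of the `ft k`, followed by those of `f k₀` rescaled to have
  -- integral one.
  set C : Matrix (Fin (n + 1)) (Fin (n + 1)) ℝ := Matrix.of fun k => Fin.lastCases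
    (motive := fun _ => Fin (n + 1) → ℝ) (Pi.single k₀ (∫ t in Set.Ioi 0, f k₀ t)⁻¹) c k with hC
  have hCl : C (Fin.last n) = Pi.single k₀ (∫ t in Set.Ioi 0, f k₀ t)⁻¹ := by
    funext j; simp [hC]
  have hCc : ∀ k : Fin n, C k.castSucc = c k := by
    intro k; funext j; simp [hC]
  set F : Fin (n + 1) → ℝ → ℝ := fun k => ∑ j, C k j • f j with hF
  have hFc : ∀ k : Fin n, F k.castSucc = ft k := fun k => by rw [hF, hc]; simp only [hCc]
  have hFl : ∫ t in Set.Ioi 0, F (Fin.last n) t = 1 := by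
    rw [hF, integral_sum_smul hf, hCl, Finset.sum_eq_single k₀]
    · rw [Pi.single_eq_same, inv_mul_cancel₀ hk₀]
    · intro j _ hj
      rw [Pi.single_eq_of_ne hj, zero_mul]
    · simp
  have hFint : ∀ k, IntegrableOn (F k) (Set.Ioi 0) := fun k => integrableOn_sum_smul hf _
  refine ⟨C.det, ?_, ?_⟩
  · intro h0
    obtain ⟨v, hv, hvC⟩ := Matrix.exists_vecMul_eq_zero_iff.mpr h0
    apply hv
    have hsum : ∑ k, v k • F k = 0 := by
      have : ∑ k, v k • F k = ∑ j, (v ᵥ* C) j • f j := by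
        simp only [hF, Finset.smul_sum, Matrix.vecMul, dotProduct, Finset.sum_smul, smul_smul]
        rw [Finset.sum_comm]
      rw [this, hvC]
      simp
    -- Integrating the relation over the half line kills all terms but the last.
    have hlast : v (Fin.last n) = 0 := by
      have h1 := integral_sum_smul hFint v
      rw [hsum, Fin.sum_univ_castSucc, hFl] at h1
      simp only [hFc, hft0] at h1
      simpa using h1.symm
    have hrest : ∀ k : Fin n, v k.castSucc = 0 := by
      have h1 : ∑ k : Fin n, v k.castSucc • ft k = 0 := by
        apply Subtype.ext
        rw [Fin.sum_univ_castSucc, hlast, zero_smul, add_zero] at hsum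
        simp only [hFc] at hsum
        refine Eq.trans ?_ hsum
        simp
      exact Fintype.linearIndependent_iff.mp ft.linearIndependent _ h1
    funext k
    exact Fin.lastCases hlast hrest k
  · intro y hy
    have h1 : initialIntegrals F y = initialIntegrals f y * Cᵀ := by
      ext j k
      rw [Matrix.mul_apply]
      simp only [initialIntegrals, Matrix.of_apply, Matrix.transpose_apply]
      rw [hF, integral_sum_smul fun k => (hf k).mono_set (initialCell_subset y j)]
      exact Finset.sum_congr rfl fun _ _ => mul_comm _ _
    have h2 : (initialIntegrals F y).det = C.det * (initialIntegrals f y).det := by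
      rw [h1, Matrix.det_mul, Matrix.det_transpose, mul_comm]
    -- The last row, of integrals over `(0, ∞)`, is `(0, …, 0, 1)`.
    rw [← h2, Matrix.det_succ_row _ (Fin.last n), Finset.sum_eq_single (Fin.last n)]
    · have h3 : initialIntegrals F y (Fin.last n) (Fin.last n) = 1 := by
        rw [initialIntegrals, Matrix.of_apply, initialCell_last, hFl]
      rw [h3, ← two_mul, pow_mul, neg_one_sq, one_pow, one_mul, one_mul]
      congr 1
      ext j k
      simp only [Matrix.of_apply, Matrix.submatrix_apply, Fin.succAbove_last, initialIntegrals,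
        initialCell_castSucc, hFc]
      rw [intervalIntegral.integral_of_le (hy j).le, integral_Ioc_eq_integral_Ioo]
    · intro k _ hk
      obtain ⟨k, rfl⟩ := Fin.exists_castSucc_eq.mpr hk
      have h3 : initialIntegrals F y (Fin.last n) k.castSucc = 0 := by
        rw [initialIntegrals, Matrix.of_apply, initialCell_last, hFc, hft0]
      rw [h3, mul_zero, zero_mul]
    · simp

/-! ### Moments of the primitives -/

lemma continuousOn_intervalIntegral_of_integrableOn_Ioi {u : ℝ → ℝ}
    (hu : IntegrableOn u (Set.Ioi 0)) :
    ContinuousOn (fun y => ∫ t in (0 : ℝ)..y, u t) (Set.Ioi 0) := by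
  have h1 : Integrable ((Set.Ioi (0 : ℝ)).indicator u) := hu.integrable_indicator measurableSet_Ioi
  have h2 : Continuous fun y => ∫ t in (0 : ℝ)..y, (Set.Ioi (0 : ℝ)).indicator u t :=
    intervalIntegral.continuous_primitive (fun a b => h1.intervalIntegrable) 0
  refine h2.continuousOn.congr fun y hy => ?_
  refine intervalIntegral.integral_congr_ae (Filter.Eventually.of_forall fun t ht => ?_)
  rw [Set.uIoc_of_le (le_of_lt hy)] at ht
  rw [Set.indicator_of_mem (show t ∈ Set.Ioi 0 from ht.1)]

/-- As the total integral vanishes, the primitive at `y` is minus the tail integral over `(y, ∞)`.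
There `y ^ j ≤ t ^ j`, and by Tonelli the integral over `0 < y < t` supplies one more factor `t`. -/
lemma integrableOn_pow_mul_primitive {u : ℝ → ℝ} (hu : IntegrableOn u (Set.Ioi 0))
    (h0 : ∫ t in Set.Ioi 0, u t = 0) (j : ℕ)
    (hj : IntegrableOn (fun t => t ^ (j + 1) * u t) (Set.Ioi 0)) :
    IntegrableOn (fun y => y ^ j * ∫ t in (0 : ℝ)..y, u t) (Set.Ioi 0) := by
  have hcont : ContinuousOn (fun y => y ^ j * ∫ t in (0 : ℝ)..y, u t) (Set.Ioi 0) :=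
    (continuous_pow j).continuousOn.mul (continuousOn_intervalIntegral_of_integrableOn_Ioi hu)
  refine ⟨hcont.aestronglyMeasurable measurableSet_Ioi, ?_⟩
  have hbound : ∀ y ∈ Set.Ioi (0 : ℝ), ‖y ^ j * ∫ t in (0 : ℝ)..y, u t‖ₑ ≤
      ∫⁻ t in Set.Ioi 0, (Set.Ioi y).indicator (fun t => ENNReal.ofReal (t ^ j) * ‖u t‖ₑ) t := by
    intro y hy
    have hy0 : (0 : ℝ) < y := hy
    have h1 : ∫ t in (0 : ℝ)..y, u t = -∫ t in Set.Ioi y, u t := by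
      have := intervalIntegral.integral_interval_add_Ioi (μ := volume) hu
        (hu.mono_set (Set.Ioi_subset_Ioi hy0.le))
      rw [h0] at this
      linarith
    rw [lintegral_indicator measurableSet_Ioi, Measure.restrict_restrict measurableSet_Ioi,
      Set.inter_eq_left.mpr (Set.Ioi_subset_Ioi hy0.le), h1, enorm_mul, enorm_neg]
    calc ‖y ^ j‖ₑ * ‖∫ t in Set.Ioi y, u t‖ₑ ≤ ‖y ^ j‖ₑ * ∫⁻ t in Set.Ioi y, ‖u t‖ₑ := by
          gcongr
          exact enorm_integral_le_lintegral_enorm _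
      _ = ∫⁻ t in Set.Ioi y, ‖y ^ j‖ₑ * ‖u t‖ₑ := by
          rw [lintegral_const_mul' _ _ enorm_ne_top]
      _ ≤ _ := by
          refine setLIntegral_mono' measurableSet_Ioi fun t ht => ?_
          have ht' : y < t := ht
          rw [Real.enorm_of_nonneg (by positivity)]
          gcongr
  have hm : AEMeasurable u (volume.restrict (Set.Ioi 0)) := hu.aestronglyMeasurable.aemeasurable
  calc ∫⁻ y in Set.Ioi (0 : ℝ), ‖y ^ j * ∫ t in (0 : ℝ)..y, u t‖ₑ
      ≤ ∫⁻ y in Set.Ioi (0 : ℝ), ∫⁻ t in Set.Ioi 0,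
        (Set.Ioi y).indicator (fun t => ENNReal.ofReal (t ^ j) * ‖u t‖ₑ) t :=
        setLIntegral_mono' measurableSet_Ioi hbound
    _ = ∫⁻ t in Set.Ioi 0, ∫⁻ y in Set.Ioi (0 : ℝ),
        (Set.Ioi y).indicator (fun t => ENNReal.ofReal (t ^ j) * ‖u t‖ₑ) t := by
        refine lintegral_lintegral_swap ?_
        have h1 : AEMeasurable (fun q : ℝ × ℝ => ENNReal.ofReal (q.2 ^ j) * ‖u q.2‖ₑ)
            ((volume.restrict (Set.Ioi 0)).prod (volume.restrict (Set.Ioi 0))) :=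
          (ENNReal.measurable_ofReal.comp (measurable_snd.pow_const j)).aemeasurable.mul
            hm.comp_snd.enorm
        exact h1.indicator (measurableSet_lt measurable_fst measurable_snd)
    _ ≤ ∫⁻ t in Set.Ioi 0, ‖t ^ (j + 1) * u t‖ₑ := by
        refine setLIntegral_mono' measurableSet_Ioi fun t ht => ?_
        have ht0 : (0 : ℝ) < t := ht
        have h1 : ∀ y, (Set.Ioi y).indicator (fun t => ENNReal.ofReal (t ^ j) * ‖u t‖ₑ) t =
            (Set.Iio t).indicator (fun _ => ENNReal.ofReal (t ^ j) * ‖u t‖ₑ) y := fun y => rfl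
        simp only [h1]
        rw [lintegral_indicator measurableSet_Iio, Measure.restrict_restrict measurableSet_Iio,
          lintegral_const, Measure.restrict_apply_univ, Set.Iio_inter_Ioi, Real.volume_Ioo,
          sub_zero, enorm_mul, Real.enorm_of_nonneg (show 0 ≤ t ^ (j + 1) by positivity), pow_succ,
          ENNReal.ofReal_mul (by positivity)]
        exact le_of_eq (by ring)
    _ < ⊤ := hj.2

/-! ### Identifying laws of unordered singular values -/

lemma measurable_comp_perm {n : ℕ} (σ : Equiv.Perm (Fin n)) :
    Measurable fun y : Fin n → ℝ => y ∘ σ :=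
  (measurePreserving_comp_perm σ).measurable

lemma lintegral_squaredSingularValuesLaw {Ω : Type*} [MeasurableSpace Ω] (μ : Measure Ω)
    {m n : ℕ} {X : Ω → Matrix (Fin m) (Fin n) ℂ} (hX : Measurable X)
    {h : (Fin n → ℝ) → ℝ≥0∞} (hh : Measurable h) :
    ∫⁻ x, h x ∂squaredSingularValuesLaw μ X =
      ((n ! : ℕ) : ℝ≥0∞)⁻¹ * ∑ σ : Equiv.Perm (Fin n),
        ∫⁻ ω, h (squaredSingularValues (X ω) ∘ σ) ∂μ := by
  rw [squaredSingularValuesLaw, lintegral_smul_measure, lintegral_finsetSum_measure, smul_eq_mul]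
  congr 1
  refine Finset.sum_congr rfl fun σ _ => ?_
  have hm : Measurable fun ω => squaredSingularValues (X ω) ∘ σ :=
    (measurable_comp_perm σ).comp (measurable_squaredSingularValues.comp hX)
  exact lintegral_map hh hm

lemma inv_factorial_mul_card_perm {n : ℕ} (a : ℝ≥0∞) :
    ((n ! : ℕ) : ℝ≥0∞)⁻¹ * ∑ _σ : Equiv.Perm (Fin n), a = a := by
  rw [Finset.sum_const, Finset.card_univ, Fintype.card_perm, Fintype.card_fin, nsmul_eq_mul,
    ← mul_assoc, ENNReal.inv_mul_cancel, one_mul]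
  · exact_mod_cast n.factorial_ne_zero
  · exact ENNReal.natCast_ne_top _

lemma lintegral_symmetric_squaredSingularValues {Ω : Type*} [MeasurableSpace Ω] (μ : Measure Ω)
    {m n : ℕ} {X : Ω → Matrix (Fin m) (Fin n) ℂ} (hX : Measurable X)
    {h : (Fin n → ℝ) → ℝ≥0∞} (hh : Measurable h)
    (hs : ∀ y (σ : Equiv.Perm (Fin n)), h (y ∘ σ) = h y) :
    ∫⁻ ω, h (squaredSingularValues (X ω)) ∂μ = ∫⁻ x, h x ∂squaredSingularValuesLaw μ X := by
  rw [lintegral_squaredSingularValuesLaw μ hX hh]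
  simp only [hs]
  rw [inv_factorial_mul_card_perm]

lemma polynomialEnsembleDensity_mul {n : ℕ} (f : Fin n → ℝ → ℝ) (Z a : ℝ) (x : Fin n → ℝ) :
    polynomialEnsembleDensity f (Z / a) x = a * polynomialEnsembleDensity f Z x := by
  unfold polynomialEnsembleDensity
  split_ifs
  · rw [inv_div, div_eq_mul_inv]
    ring
  · rw [mul_zero]

/-- It suffices to identify the law of the singular values through symmetric functions and up to a
constant factor. -/
lemma squaredSingularValuesArePolynomialEnsemble_of_lintegral {Ω : Type*} [MeasurableSpace Ω]
    {μ : Measure Ω} [IsProbabilityMeasure μ] {m n : ℕ} {Y : Ω → Matrix (Fin m) (Fin n) ℂ}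
    (hY : Measurable Y) {g : Fin n → ℝ → ℝ} {Z : ℝ} (hZ : Z ≠ 0) {κ : ℝ≥0∞} (hκ0 : κ ≠ 0)
    (hκt : κ ≠ ⊤)
    (hmom : ∀ j k : Fin n, IntegrableOn (fun x : ℝ => x ^ (j : ℕ) * g k x) (Set.Ioi 0))
    (hnn : ∀ x, 0 ≤ polynomialEnsembleDensity g Z x)
    (hE : ∀ H : (ℕ → ℝ) → ℝ≥0∞, Measurable H →
      ∫⁻ ω, H (charValues (squaredSingularValues (Y ω))) ∂μ =
        κ * ∫⁻ y, ENNReal.ofReal (polynomialEnsembleDensity g Z y) * H (charValues y)) :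
    SquaredSingularValuesArePolynomialEnsemble μ Y g := by
  -- The constant `κ` is absorbed into the normalization `Z / κ`; testing with `H = 1` then gives
  -- mass one.
  have ha : 0 < κ.toReal := ENNReal.toReal_pos hκ0 hκt
  set P : (Fin n → ℝ) → ℝ≥0∞ :=
    fun y => ENNReal.ofReal (polynomialEnsembleDensity g (Z / κ.toReal) y) with hP
  have hPm : AEMeasurable P := by
    refine ENNReal.measurable_ofReal.comp_aemeasurable
      (aemeasurable_polynomialEnsembleDensity _ fun k => ?_)
    have := hmom ⟨0, k.pos⟩ k
    simpa using this.aestronglyMeasurable.aemeasurable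
  have hPe : ∀ y, P y = κ * ENNReal.ofReal (polynomialEnsembleDensity g Z y) := by
    intro y
    simp only [hP]
    rw [polynomialEnsembleDensity_mul, ENNReal.ofReal_mul ha.le, ENNReal.ofReal_toReal hκt]
  have hPs : ∀ y (σ : Equiv.Perm (Fin n)), P (y ∘ σ) = P y := by
    intro y σ
    simp only [hP, polynomialEnsembleDensity_comp_perm]
  have hE' : ∀ H : (ℕ → ℝ) → ℝ≥0∞, Measurable H →
      ∫⁻ ω, H (charValues (squaredSingularValues (Y ω))) ∂μ =
        ∫⁻ y, P y * H (charValues y) := by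
    intro H hH
    rw [hE H hH, ← lintegral_const_mul' _ _ hκt]
    simp only [hPe, mul_assoc]
  refine ⟨Z / κ.toReal, ⟨div_ne_zero hZ ha.ne', hmom, fun x => ?_, ?_⟩, ?_⟩
  · rw [polynomialEnsembleDensity_mul]
    exact mul_nonneg ha.le (hnn x)
  · have := hE' (fun _ => 1) measurable_const
    simpa using this.symm
  · refine Measure.ext_of_lintegral _ fun h hh => ?_
    rw [lintegral_squaredSingularValuesLaw μ hY hh]
    -- The unordered law and the symmetric density see only the symmetrization of a test function,
    -- which is a function of the code.
    set S : (Fin n → ℝ) → ℝ≥0∞ := fun y => ∑ σ : Equiv.Perm (Fin n), h (y ∘ σ) with hS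
    have hSm : Measurable S :=
      Finset.measurable_fun_sum _ fun σ _ => hh.comp (measurable_comp_perm σ)
    have hSs : ∀ y (σ : Equiv.Perm (Fin n)), S (y ∘ σ) = S y := by
      intro y σ
      exact Fintype.sum_equiv (Equiv.mulLeft σ) _ _ fun τ => rfl
    obtain ⟨H, hH, hHe⟩ := exists_eq_comp_charValues hSm hSs
    have h1 : ∑ σ : Equiv.Perm (Fin n), ∫⁻ ω, h (squaredSingularValues (Y ω) ∘ σ) ∂μ =
        ∫⁻ ω, S (squaredSingularValues (Y ω)) ∂μ := by
      exact (lintegral_finsetSum _ fun σ _ => hh.comp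
        ((measurable_comp_perm σ).comp (measurable_squaredSingularValues.comp hY))).symm
    have h2 : ∫⁻ y, P y * S y = ∑ σ : Equiv.Perm (Fin n), ∫⁻ y, P y * h (y ∘ σ) := by
      simp only [hS, Finset.mul_sum]
      exact lintegral_finsetSum' _ fun σ _ =>
        hPm.mul (hh.comp (measurable_comp_perm σ)).aemeasurable
    have h3 : ∀ σ : Equiv.Perm (Fin n), ∫⁻ y, P y * h (y ∘ σ) = ∫⁻ y, P y * h y := by
      intro σ
      rw [← lintegral_comp_perm σ fun y => P y * h y]
      simp only [hPs]
    rw [h1]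
    simp only [hHe]
    rw [hE' H hH]
    simp only [← hHe]
    rw [h2]
    simp only [h3]
    rw [inv_factorial_mul_card_perm, lintegral_withDensity_eq_lintegral_mul₀ hPm hh.aemeasurable]
    rfl

/-! ### The random matrix after removal of a column -/

lemma measurable_mul_submatrix {m n : ℕ} (p : Fin (n + 1)) :
    Measurable fun q : Matrix (Fin m) (Fin (n + 1)) ℂ × Matrix.unitaryGroup (Fin (n + 1)) ℂ =>
      (q.1 * (q.2 : Matrix (Fin (n + 1)) (Fin (n + 1)) ℂ)).submatrix id p.succAbove := by
  rw [measurable_matrix_iff]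
  intro i j
  simp only [Matrix.submatrix_apply, id, Matrix.mul_apply]
  refine Finset.measurable_fun_sum _ fun k _ => Measurable.mul ?_ ?_
  · exact (measurable_matrix_entry i k).comp measurable_fst
  · exact (measurable_unitary_entry k _).comp measurable_snd

lemma lintegral_corner {Ω : Type*} [MeasurableSpace Ω] {μ : Measure Ω} [IsProbabilityMeasure μ]
    {m n : ℕ} {X : Ω → Matrix (Fin m) (Fin (n + 1)) ℂ} (hX : Measurable X)
    {f : Fin (n + 1) → ℝ → ℝ} {Z : ℝ}
    (hf : ∀ k, IntegrableOn (f k) (Set.Ioi 0))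
    (hlaw : squaredSingularValuesLaw μ X =
      volume.withDensity fun x => ENNReal.ofReal (polynomialEnsembleDensity f Z x))
    {U : Ω → Matrix.unitaryGroup (Fin (n + 1)) ℂ} (hU : Measurable U)
    (hinv : ∀ W : Matrix.unitaryGroup (Fin (n + 1)) ℂ,
      (μ.map U).map (fun V => W * V) = μ.map U) (hXU : IndepFun X U μ) (p : Fin (n + 1)) :
    ∃ c : ℝ≥0∞, c ≠ 0 ∧ c ≠ ⊤ ∧ ∀ H : (ℕ → ℝ) → ℝ≥0∞, Measurable H →
      ∫⁻ ω, H (charValues (squaredSingularValues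
        ((X ω * (U ω : Matrix (Fin (n + 1)) (Fin (n + 1)) ℂ)).submatrix id p.succAbove))) ∂μ =
      c * ∫⁻ x, ENNReal.ofReal (polynomialEnsembleDensity f Z x) * simplexAverage H x := by
  have hprob : IsProbabilityMeasure (μ.map U) := Measure.isProbabilityMeasure_map hU.aemeasurable
  obtain ⟨c, hc0, hct, hc⟩ := lintegral_haar_corner (μ.map U) hinv p
  refine ⟨c, hc0, hct, fun H hH => ?_⟩
  set G : Matrix (Fin m) (Fin (n + 1)) ℂ × Matrix.unitaryGroup (Fin (n + 1)) ℂ → ℝ≥0∞ :=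
    fun q => H (charValues (squaredSingularValues
      ((q.1 * (q.2 : Matrix (Fin (n + 1)) (Fin (n + 1)) ℂ)).submatrix id p.succAbove))) with hG
  have hGm : Measurable G := hH.comp (continuous_charValues.measurable.comp
    (measurable_squaredSingularValues.comp (measurable_mul_submatrix p)))
  have hAm := measurable_simplexAverage (n := n) hH
  have h1 : ∫⁻ ω, G (X ω, U ω) ∂μ = ∫⁻ A, ∫⁻ V, G (A, V) ∂μ.map U ∂μ.map X := by
    rw [← lintegral_prod _ hGm.aemeasurable,
      ← (indepFun_iff_map_prod_eq_prod_map_map hX.aemeasurable hU.aemeasurable).mp hXU,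
      lintegral_map hGm (hX.prodMk hU)]
  have h2 : ∀ A, ∫⁻ V, G (A, V) ∂μ.map U = c * simplexAverage H (squaredSingularValues A) :=
    fun A => hc m A H hH
  have hDm : AEMeasurable fun x => ENNReal.ofReal (polynomialEnsembleDensity f Z x) :=
    ENNReal.measurable_ofReal.comp_aemeasurable (aemeasurable_polynomialEnsembleDensity Z
      fun k => (hf k).aestronglyMeasurable.aemeasurable)
  refine h1.trans ?_
  simp only [h2]
  have h3 : Measurable fun A : Matrix (Fin m) (Fin (n + 1)) ℂ =>
      simplexAverage H (squaredSingularValues A) := hAm.comp measurable_squaredSingularValues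
  rw [lintegral_const_mul' _ _ hct, lintegral_map h3 hX,
    lintegral_symmetric_squaredSingularValues μ hX hAm fun y σ => simplexAverage_comp_perm H y σ,
    hlaw, lintegral_withDensity_eq_lintegral_mul₀ hDm hAm.aemeasurable]
  rfl

lemma polynomialEnsembleDensity_nonneg_of_strictMono {n : ℕ} {g : Fin n → ℝ → ℝ} {Z : ℝ}
    (h : ∀ y, StrictMono y → 0 ≤ polynomialEnsembleDensity g Z y) (y : Fin n → ℝ) :
    0 ≤ polynomialEnsembleDensity g Z y := by
  by_cases hy : Function.Injective y
  · rw [← polynomialEnsembleDensity_comp_perm g Z y (Tuple.sort y)]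
    exact h _ ((Tuple.monotone_sort y).strictMono_of_injective (hy.comp (Tuple.sort y).injective))
  · have h0 : (Matrix.vandermonde y).det = 0 := by
      by_contra hne
      exact hy (Matrix.det_vandermonde_ne_zero_iff.mp hne)
    unfold polynomialEnsembleDensity
    split_ifs
    · rw [h0, mul_zero, zero_mul]
    · exact le_rfl

theorem corollary3p3 {Ω : Type*} [MeasurableSpace Ω] (μ : Measure Ω) [IsProbabilityMeasure μ]
    (n ν : ℕ)
    (X : Ω → Matrix (Fin (n + 1 + ν)) (Fin (n + 1)) ℂ) (hX : Measurable X)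
    (f : Fin (n + 1) → ℝ → ℝ)
    (hf : SquaredSingularValuesArePolynomialEnsemble μ X f)
    (U : Ω → Matrix.unitaryGroup (Fin (n + 1)) ℂ) (hU : Measurable U)
    (hHaar : (μ.map U).IsHaarMeasure) (hXU : IndepFun X U μ)
    (p : Fin (n + 1)) :
    Nonempty (Module.Basis (Fin n) ℝ (zeroIntegralCombinations f)) ∧
    ∀ ft : Module.Basis (Fin n) ℝ (zeroIntegralCombinations f),
      SquaredSingularValuesArePolynomialEnsemble μ
        (fun ω => (X ω * (U ω : Matrix (Fin (n + 1)) (Fin (n + 1)) ℂ)).submatrix id p.succAbove)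
        (fun k y => ∫ x in (0 : ℝ)..y, (ft k : ℝ → ℝ) x) := by
  obtain ⟨Z, hens, hlaw⟩ := hf
  have hfi : ∀ k, IntegrableOn (f k) (Set.Ioi 0) := fun k => by simpa using hens.moments 0 k
  obtain ⟨c, hc0, hct, hc⟩ := lintegral_corner hX hfi hlaw hU
    (fun W => MeasureTheory.map_mul_left_eq_self (μ.map U) W) hXU p
  set b : ℝ≥0∞ := ((n + 1) ! : ℕ) * ∫⁻ s in Set.Ioc (0 : ℝ) 1, ENNReal.ofReal (s ^ n) with hb
  have hb0 : b ≠ 0 := mul_ne_zero (by exact_mod_cast (n + 1).factorial_ne_zero)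
    (lintegral_Ioc_pow_ne_zero n)
  have hbt : b ≠ ⊤ := ENNReal.mul_ne_top (ENNReal.natCast_ne_top _) (lintegral_Ioc_pow_ne_top n)
  have hE : ∀ H : (ℕ → ℝ) → ℝ≥0∞, Measurable H → _ := fun H hH =>
    (hc H hH).trans (congrArg (c * ·) (lintegral_density_mul_simplexAverage hfi hens.nonneg hH))
  -- If the determinant vanished identically, testing with `H = 1` would give `1 = 0`.
  have hdet : ∃ y : Fin n → ℝ, (initialIntegrals f y).det ≠ 0 := by
    by_contra! h0
    have h1 := hE (fun _ => 1) measurable_const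
    simp [h0] at h1
  obtain ⟨y₀, hy₀⟩ := hdet
  have hli := linearIndependent_of_det_initialIntegrals_ne_zero hfi hy₀
  have hne := exists_integral_ne_zero_of_det_initialIntegrals_ne_zero hy₀
  refine ⟨nonempty_basis_zeroIntegralCombinations hfi hli hne, fun ft => ?_⟩
  obtain ⟨d, hd0, hd⟩ := exists_det_initialIntegrals_eq hfi hne ft
  set g : Fin n → ℝ → ℝ := fun k y => ∫ x in (0 : ℝ)..y, (ft k : ℝ → ℝ) x with hg
  have hdens : ∀ y : Fin n → ℝ, (∀ j, 0 < y j) → polynomialEnsembleDensity g (Z * d) y =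
      Z⁻¹ * (Matrix.vandermonde y).det * (initialIntegrals f y).det := by
    intro y hy
    rw [polynomialEnsembleDensity_of_pos hy, hd y hy]
    field_simp
  have hY : Measurable fun ω =>
      (X ω * (U ω : Matrix (Fin (n + 1)) (Fin (n + 1)) ℂ)).submatrix id p.succAbove :=
    (measurable_mul_submatrix p).comp (hX.prodMk hU)
  have hfac0 : ((n ! : ℕ) : ℝ≥0∞) ≠ 0 := by exact_mod_cast n.factorial_ne_zero
  have hfact : ((n ! : ℕ) : ℝ≥0∞) ≠ ⊤ := ENNReal.natCast_ne_top _
  -- The factor `1 / n!` in `κ` converts the integral over the chamber into one over the whole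
  -- space.
  refine squaredSingularValuesArePolynomialEnsemble_of_lintegral hY (Z := Z * d)
    (κ := c * (b * ((n ! : ℕ) : ℝ≥0∞)⁻¹)) (mul_ne_zero hens.normalization_ne_zero hd0)
    (mul_ne_zero hc0 (mul_ne_zero hb0 (ENNReal.inv_ne_zero.mpr hfact)))
    (ENNReal.mul_ne_top hct (ENNReal.mul_ne_top hbt (ENNReal.inv_ne_top.mpr hfac0))) ?_ ?_ ?_
  · intro j k
    obtain ⟨⟨a, ha⟩, hint, hzero⟩ := (ft k).2
    refine integrableOn_pow_mul_primitive hint hzero j ?_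
    have h1 : (fun t => t ^ ((j : ℕ) + 1) * (ft k : ℝ → ℝ) t) =
        ∑ l, a l • fun t => t ^ ((j : ℕ) + 1) * f l t := by
      funext t
      rw [ha]
      simp only [Finset.sum_apply, Pi.smul_apply, smul_eq_mul, Finset.mul_sum]
      exact Finset.sum_congr rfl fun l _ => by ring
    rw [h1]
    -- The `j`-th moment of a primitive needs the moment of order `j + 1 ≤ n` of each `f l`, which
    -- the larger ensemble provides.
    exact integrableOn_sum_smul (fun l => by simpa using hens.moments j.succ l) a
  · refine polynomialEnsembleDensity_nonneg_of_strictMono fun y hy => ?_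
    by_cases hy0 : ∀ j, 0 < y j
    · rw [hdens y hy0, mul_right_comm]
      exact mul_nonneg (integral_interlacing hfi hens.nonneg hy).1 (det_vandermonde_pos hy).le
    · rw [polynomialEnsembleDensity, if_neg hy0]
  · intro H hH
    refine (hE H hH).trans ?_
    rw [lintegral_eq_factorial_mul_setLIntegral_strictMono (n := n)]
    · rw [mul_assoc c, mul_assoc b, ← mul_assoc (((n ! : ℕ) : ℝ≥0∞)⁻¹),
        ENNReal.inv_mul_cancel hfac0 hfact, one_mul]
      simp only [hb]
      congr 2
      refine lintegral_congr fun y => ?_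
      by_cases hy0 : ∀ j, 0 < y j
      · rw [hdens y hy0, Set.indicator_of_mem (show y ∈ {y : Fin n → ℝ | ∀ j, 0 < y j} from hy0)]
      · rw [polynomialEnsembleDensity, if_neg hy0,
          Set.indicator_of_notMem (show y ∉ {y : Fin n → ℝ | ∀ j, 0 < y j} from hy0),
          ENNReal.ofReal_zero]
    · intro y σ
      rw [polynomialEnsembleDensity_comp_perm, charValues_comp_perm]
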